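/- For $l\ge 1$, positive integers $s_1,\dots,s_l$ and signs $x_1,\dots,x_l\in\{1,-1\}$ with $(s_1,x_1)\neq(1,1)$, the (alternating) Euler sum of weight $s_1+\cdots+s_l$ is $$\zeta(s_1,\dots,s_l;x_1,\dots,x_l)=\lim_{N\to\infty}\ \sum_{N\ge k_1>\cdots>k_l>0}\ \prod_{j=1}^l\frac{x_j^{k_j}}{k_j^{s_j}}.$$ One writes $\bar s_j$ for $s_j$ when $x_j=-1$ and omits the signs $x_j$; thus $\zeta(\bar 1)=-\ln 2$. (0) The limits defining the Euler sums of weight $5$ exist. (1) Every Euler sum of weight $5$ is a $\mathbb Q$-linear combination of the eight sums $$\zeta(\bar1,1,1,1,1),\ \zeta(\bar1,1,2,1),\ \zeta(\bar2,1,1,1),\ \zeta(\bar1,1,1,2),\ \zeta(\bar1,2,1,1),\ \zeta(\bar2,1,2),\ \zeta(\bar2,2,1),\ \zeta(\bar1,2,2).$$ In particular $$\zeta(3,1,1)=-\frac{448}{39}\zeta(\bar2,1,1,1)-\frac{112}{39}\zeta(\bar2,2,1)-\frac{48}{13}\zeta(\bar2,1,2).$$ (2) Every Euler sum of weight $5$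 is a $\mathbb Z$-linear combination of $$A=\zeta(\bar1,\bar1,\bar1,2),\ B=\zeta(\bar2,1,\bar1,\bar1),\ C=\zeta(\bar1,1,\bar1,\bar2),\ D=\zeta(\bar2,1,1,1),$$ $$E=\zeta(\bar1,\bar1,\bar1,1,1),\ F=\zeta(2,2,\bar1),\ G=\zeta(\bar1,1,\bar1,1,\bar1),\ H=\zeta(\bar1,\bar1,\bar1,\bar1,\bar1).$$ Explicitly, writing $[c_1,\dots,c_8]$ for $c_1A+c_2B+c_3C+c_4D+c_5E+c_6F+c_7G+c_8H$, the other $100$ Euler sums of weight $5$ are: Length one and two: $$\begin{array}{rl} \zeta(5)&=[-13504,1856,-1344,26880,-18752,-640,-31552,50304] \\ \zeta(\bar5)&=[12660,-1740,1260,-25200,17580,600,29580,-47160] \\ \zeta(4,1)&=[-9808,1344,-944,19632,-13648,-464,-22848,36496] \\ \zeta(4,\bar1)&=[-14918,2044,-1434,29862,-20758,-704,-34748,55506] \\ \zeta(\bar4,1)&=[3638,-498,346,-7296,5066,172,8466,-13532] \\ \zeta(\bar4,\bar1)&=[19862,-2722,1914,-39744,27634,938,46274,-73908] \\ \zeta(3,2)&=[22672,-3104,2160,-45456,31568,1072,52768,-84336]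 \\ \zeta(3,\bar2)&=[4562,-626,446,-9108,6342,216,10642,-16984] \\ \zeta(\bar3,2)&=[-6552,898,-632,13110,-9116,-310,-15266,24382] \\ \zeta(\bar3,\bar2)&=[-17848,2444,-1704,35772,-24848,-844,-41548,66396] \\ \zeta(2,3)&=[-26368,3616,-2560,52704,-36672,-1248,-61472,98144] \\ \zeta(2,\bar3)&=[6792,-934,680,-13506,9428,322,15878,-25306] \\ \zeta(\bar2,\bar3)&=[24902,-3412,2394,-49854,34654,1178,58004,-92658] \\ \zeta(\bar2,3)&=[-8622,1182,-834,17244,-11994,-408,-20094,32088] \\ \zeta(\bar1,4)&=[5266,-720,494,-10582,7338,248,12240,-19578] \\ \zeta(\bar1,\bar4)&=[-8990,1230,-850,18044,-12522,-424,-20910,33432] \end{array}$$ Length three: $$\begin{array}{rl} \zeta(3,1,1)&=[-9808,1344,-944,19632,-13648,-464,-22848,36496] \\ \zeta(3,1,\bar1)&=[-5314,725,-500,10677,-7402,-250,-12339,19741] \\ \zeta(3,\bar1,1)&=[-2257,312,-225,4489,-3137,-108,-5290,8427] \\ \zeta(3,\bar1,\bar1)&=[-7299,1005,-713,14566,-10151,-347,-17057,27208]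 \\ \zeta(\bar3,1,1)&=[4482,-614,430,-8974,6238,212,10438,-16676] \\ \zeta(\bar3,1,\bar1)&=[9570,-1308,908,-19204,13328,452,22250,-35578] \\ \zeta(\bar3,\bar1,1)&=[12462,-1710,1204,-24924,17338,590,29056,-46394] \\ \zeta(\bar3,\bar1,\bar1)&=[-4288,582,-396,8646,-5978,-201,-9922,15900] \\ \zeta(2,2,1)&=[22672,-3104,2160,-45456,31568,1072,52768,-84336] \\ \zeta(2,\bar2,1)&=[3025,-414,287,-6065,4213,143,7038,-11251] \\ \zeta(2,\bar2,\bar1)&=[6421,-881,627,-12818,8927,303,14977,-23904] \\ \zeta(2,1,2)&=[-26368,3616,-2560,52704,-36672,-1248,-61472,98144] \\ \zeta(2,\bar1,2)&=[2206,-302,210,-4428,3074,104,5134,-8208] \\ \zeta(2,1,\bar2)&=[7958,-1093,786,-15861,11056,377,18581,-29637] \\ \zeta(2,\bar1,\bar2)&=[23513,-3221,2255,-47094,32727,1113,54757,-87484] \\ \zeta(\bar2,2,1)&=[-12813,1755,-1227,25664,-17835,-606,-29835,47670] \\ \zeta(\bar2,2,\bar1)&=[-20468,2804,-1964,40988,-28488,-968,-47668,76156]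 \\ \zeta(\bar2,\bar2,1)&=[-5477,750,-523,10977,-7625,-259,-12750,20375] \\ \zeta(\bar2,\bar2,\bar1)&=[12308,-1686,1180,-24654,17132,582,28662,-45794] \\ \zeta(\bar2,1,2)&=[12622,-1729,1210,-25281,17568,597,29393,-46961] \\ \zeta(\bar2,1,\bar2)&=[-3065,420,-295,6135,-4265,-145,-7140,11405] \\ \zeta(\bar2,\bar1,2)&=[-14047,1923,-1337,28170,-19561,-665,-32691,52252] \\ \zeta(\bar2,\bar1,\bar2)&=[-9411,1290,-909,18831,-13095,-445,-21930,35025] \\ \zeta(\bar1,3,1)&=[123,-17,13,-242,171,6,289,-460] \\ \zeta(\bar1,3,\bar1)&=[-11820,1614,-1120,23726,-16460,-557,-27466,43926] \\ \zeta(\bar1,\bar3,1)&=[6380,-874,612,-12776,8880,302,14858,-23738] \\ \zeta(\bar1,\bar3,\bar1)&=[12610,-1722,1194,-25312,17560,594,29302,-46862] \\ \zeta(\bar1,2,2)&=[-190,26,-18,384,-266,-9,-442,708] \\ \zeta(\bar1,2,\bar2)&=[13726,-1880,1314,-27494,19106,649,31960,-51066] \\ \zeta(\bar1,\bar2,2)&=[-13631,1867,-1305,27302,-18973,-644,-31739,50712]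 \\ \zeta(\bar1,\bar2,\bar2)&=[599,-82,57,-1203,835,28,1394,-2229] \\ \zeta(\bar1,1,3)&=[-3186,435,-300,6399,-4438,-150,-7401,11839] \\ \zeta(\bar1,1,\bar3)&=[-2732,376,-268,5448,-3798,-130,-6384,10182] \\ \zeta(\bar1,\bar1,3)&=[20431,-2799,1969,-40888,28427,966,47591,-76018] \\ \zeta(\bar1,\bar1,\bar3)&=[-7808,1070,-758,15608,-10858,-369,-18196,29054] \end{array}$$ Length four: $$\begin{array}{rl} \zeta(2,1,1,1)&=[-13504,1856,-1344,26880,-18752,-640,-31552,50304] \\ \zeta(2,1,1,\bar1)&=[-11109,1518,-1044,22320,-15477,-523,-25812,41289] \\ \zeta(2,1,\bar1,1)&=[1174,-158,101,-2395,1642,54,2691,-4333] \\ \zeta(2,1,\bar1,\bar1)&=[14927,-2044,1431,-29899,20773,705,34745,-55518] \\ \zeta(2,\bar1,1,1)&=[-2712,371,-258,5439,-3777,-128,-6306,10083] \\ \zeta(2,\bar1,1,\bar1)&=[-14828,2030,-1419,29709,-20641,-701,-34517,55158] \\ \zeta(2,\bar1,\bar1,1)&=[-7120,977,-681,14262,-9911,-337,-16585,26496]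 \\ \zeta(2,\bar1,\bar1,\bar1)&=[11204,-1534,1074,-22440,15595,530,26096,-41691] \\ \zeta(\bar2,\bar1,1,1)&=[8717,-1197,847,-17415,12122,412,20334,-32456] \\ \zeta(\bar2,\bar1,1,\bar1)&=[-8511,1162,-806,17085,-11852,-401,-19775,31627] \\ \zeta(\bar2,\bar1,\bar1,1)&=[3432,-470,327,-6882,4779,162,7980,-12759] \\ \zeta(\bar2,\bar1,\bar1,\bar1)&=[-652,89,-66,1296,-905,-31,-1531,2436] \\ \zeta(\bar2,1,\bar1,1)&=[8659,-1183,822,-17376,12059,409,20134,-32193] \\ \zeta(\bar2,1,1,\bar1)&=[3571,-490,344,-7145,4969,169,8322,-13291] \\ \zeta(\bar1,2,1,1)&=[190,-26,18,-384,265,9,442,-707] \\ \zeta(\bar1,2,1,\bar1)&=[190,-25,18,-385,265,9,442,-707] \\ \zeta(\bar1,2,\bar1,1)&=[-27776,3801,-2654,55667,-38668,-1313,-64648,103316] \\ \zeta(\bar1,2,\bar1,\bar1)&=[-19006,2604,-1828,38048,-26452,-900,-44288,70740] \\ \zeta(\bar1,\bar2,1,1)&=[-2407,330,-233,4812,-3347,-113,-5610,8957]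 \\ \zeta(\bar1,\bar2,1,\bar1)&=[-202,32,-34,353,-274,-12,-533,807] \\ \zeta(\bar1,\bar2,\bar1,1)&=[6507,-893,631,-13009,9054,309,15184,-24238] \\ \zeta(\bar1,\bar2,\bar1,\bar1)&=[31628,-4333,3038,-63328,44021,1497,73681,-117702] \\ \zeta(\bar1,1,2,1)&=[-122,17,-13,242,-170,-6,-288,458] \\ \zeta(\bar1,1,2,\bar1)&=[3310,-453,314,-6641,4609,156,7692,-12301] \\ \zeta(\bar1,1,\bar2,\bar1)&=[6195,-850,600,-12383,8619,294,14454,-23073] \\ \zeta(\bar1,1,\bar2,1)&=[2888,-394,272,-5803,4023,136,6706,-10729] \\ \zeta(\bar1,\bar1,2,1)&=[-7433,1019,-711,14888,-10348,-352,-17315,27663] \\ \zeta(\bar1,\bar1,2,\bar1)&=[6793,-932,658,-13586,9453,322,15848,-25301] \\ \zeta(\bar1,\bar1,\bar2,1)&=[-313,43,-30,626,-437,-15,-730,1167] \\ \zeta(\bar1,\bar1,\bar2,\bar1)&=[-18914,2592,-1822,37855,-26321,-895,-44073,70394] \\ \zeta(\bar1,1,1,2)&=[191,-26,18,-384,267,9,442,-709]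 \\ \zeta(\bar1,1,1,\bar2)&=[-2521,345,-240,5054,-3510,-119,-5864,9374] \\ \zeta(\bar1,1,\bar1,2)&=[13126,-1798,1257,-26291,18271,621,30567,-48838] \\ \zeta(\bar1,\bar1,1,2)&=[13312,-1826,1295,-26595,18512,630,31043,-49555] \\ \zeta(\bar1,\bar1,1,\bar2)&=[-4812,661,-475,9593,-6687,-228,-11237,17924] \\ \zeta(\bar1,\bar1,\bar1,\bar2)&=[-13127,1798,-1258,26291,-18271,-621,-30565,48836] \end{array}$$ Length five: $$\begin{array}{rl} \zeta(\bar1,1,1,1,1)&=[-191,26,-18,384,-266,-9,-442,709] \\ \zeta(\bar1,1,1,1,\bar1)&=[-191,26,-18,385,-266,-9,-442,709] \\ \zeta(\bar1,1,1,\bar1,1)&=[4481,-614,430,-8973,6237,212,10438,-16674] \\ \zeta(\bar1,1,1,\bar1,\bar1)&=[-1,0,0,0,-1,0,0,2] \\ \zeta(\bar1,1,\bar1,1,1)&=[-4693,643,-451,9395,-6531,-222,-10930,17462] \\ \zeta(\bar1,1,\bar1,\bar1,1)&=[-313,43,-31,626,-436,-15,-730,1167] \\ \zeta(\bar1,1,\bar1,\bar1,\bar1)&=[-13126,1798,-1258,26291,-18271,-621,-30565,48837]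 \\ \zeta(\bar1,\bar1,1,1,1)&=[7496,-1031,747,-14915,10408,355,17522,-27929] \\ \zeta(\bar1,\bar1,1,1,\bar1)&=[2081,-285,194,-4183,2901,98,4840,-7740] \\ \zeta(\bar1,\bar1,1,\bar1,1)&=[-3308,452,-313,6641,-4607,-156,-7689,12297] \\ \zeta(\bar1,\bar1,1,\bar1,\bar1)&=[-12121,1660,-1164,24269,-16868,-573,-28225,45094] \\ \zeta(\bar1,\bar1,\bar1,1,\bar1)&=[12622,-1729,1210,-25280,17569,597,29393,-46961] \\ \zeta(\bar1,\bar1,\bar1,\bar1,1)&=[10552,-1445,1008,-21144,14690,499,24565,-39254] \end{array}$$ (3) It is not the case that the eight sums in (1) are linearly independent over $\mathbb Q$ and that every Euler sum of weight $5$ is a $\mathbb Z$-linear combination of them. (So they cannot serve as a $\mathbb Z$-basis for the Euler sums of weight $5$.) -/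

import Mathlib

open Filter Topology

/-- Signed indices are written as lists of nonzero integers: a positive entry `s` stands for the
pair `(s; +1)` and a negative entry `-s` for the barred argument, that is, the pair `(s; -1)`.
The truncated sum `∑_{N ≥ k₁ > ⋯ > k_l > 0} ∏ⱼ xⱼ ^ kⱼ / kⱼ ^ sⱼ`, where `sⱼ` and `xⱼ` are the
absolute value and the sign of the `j`-th entry; the outermost variable is `k₁ = k + 1`. -/
noncomputable def eulerPartial : List ℤ → ℕ → ℝ
  | [], _ => 1
  | s :: t, N => ∑ k ∈ Finset.range N,
      (s.sign : ℝ) ^ (k + 1) / ((k : ℝ) + 1) ^ s.natAbs * eulerPartial t k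

/-- The (alternating) Euler sum of a signed index: the limit of the truncated sums. The sums with
a leading `-1` are only conditionally convergent. -/
noncomputable def eulerSum (s : List ℤ) : ℝ := limUnder atTop (eulerPartial s)

/-- The weight `s₁ + ⋯ + s_l` of a signed index. -/
def eulerWeight (s : List ℤ) : ℕ := (s.map Int.natAbs).sum

/-- The signed indices of convergent Euler sums: the entries are nonzero (positive integers with
or without a bar), and the first one is not an unbarred `1`. -/
def IsEulerIndex (s : List ℤ) : Prop := (∀ x ∈ s, x ≠ 0) ∧ s.head? ≠ some 1

/-- The set of Euler sums of weight `n`. -/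
def eulerSumsOfWeight (n : ℕ) : Set ℝ :=
  {z | ∃ s : List ℤ, IsEulerIndex s ∧ eulerWeight s = n ∧ z = eulerSum s}

/-- Zlobin's eight sums of weight five: the first entry is barred, the others are not, and all
entries are `1` or `2` in absolute value. -/
noncomputable def zlobinSum : Fin 8 → ℝ :=
  ![eulerSum [-1, 1, 1, 1, 1], eulerSum [-1, 1, 2, 1], eulerSum [-2, 1, 1, 1],
    eulerSum [-1, 1, 1, 2], eulerSum [-1, 2, 1, 1], eulerSum [-2, 1, 2],
    eulerSum [-2, 2, 1], eulerSum [-1, 2, 2]]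

/-- The eight sums `A, B, C, D, E, F, G, H` of weight five, in this order. -/
noncomputable def integralSum : Fin 8 → ℝ :=
  ![eulerSum [-1, -1, -1, 2], eulerSum [-2, 1, -1, -1], eulerSum [-1, 1, -1, -2],
    eulerSum [-2, 1, 1, 1], eulerSum [-1, -1, -1, 1, 1], eulerSum [2, 2, -1],
    eulerSum [-1, 1, -1, 1, -1], eulerSum [-1, -1, -1, -1, -1]]

/-- Each row holds a signed index of weight five (here of length one or two) and the coefficients
of its Euler sum with respect to `A, B, C, D, E, F, G, H`. -/
def integralTableLe2 : List (List ℤ × (Fin 8 → ℤ)) := [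
  ([5], ![-13504, 1856, -1344, 26880, -18752, -640, -31552, 50304]),
  ([-5], ![12660, -1740, 1260, -25200, 17580, 600, 29580, -47160]),
  ([4, 1], ![-9808, 1344, -944, 19632, -13648, -464, -22848, 36496]),
  ([4, -1], ![-14918, 2044, -1434, 29862, -20758, -704, -34748, 55506]),
  ([-4, 1], ![3638, -498, 346, -7296, 5066, 172, 8466, -13532]),
  ([-4, -1], ![19862, -2722, 1914, -39744, 27634, 938, 46274, -73908]),
  ([3, 2], ![22672, -3104, 2160, -45456, 31568, 1072, 52768, -84336]),
  ([3, -2], ![4562, -626, 446, -9108, 6342, 216, 10642, -16984]),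
  ([-3, 2], ![-6552, 898, -632, 13110, -9116, -310, -15266, 24382]),
  ([-3, -2], ![-17848, 2444, -1704, 35772, -24848, -844, -41548, 66396]),
  ([2, 3], ![-26368, 3616, -2560, 52704, -36672, -1248, -61472, 98144]),
  ([2, -3], ![6792, -934, 680, -13506, 9428, 322, 15878, -25306]),
  ([-2, -3], ![24902, -3412, 2394, -49854, 34654, 1178, 58004, -92658]),
  ([-2, 3], ![-8622, 1182, -834, 17244, -11994, -408, -20094, 32088]),
  ([-1, 4], ![5266, -720, 494, -10582, 7338, 248, 12240, -19578]),
  ([-1, -4], ![-8990, 1230, -850, 18044, -12522, -424, -20910, 33432])]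

/-- The rows for the signed indices of length three. -/
def integralTable3 : List (List ℤ × (Fin 8 → ℤ)) := [
  ([3, 1, 1], ![-9808, 1344, -944, 19632, -13648, -464, -22848, 36496]),
  ([3, 1, -1], ![-5314, 725, -500, 10677, -7402, -250, -12339, 19741]),
  ([3, -1, 1], ![-2257, 312, -225, 4489, -3137, -108, -5290, 8427]),
  ([3, -1, -1], ![-7299, 1005, -713, 14566, -10151, -347, -17057, 27208]),
  ([-3, 1, 1], ![4482, -614, 430, -8974, 6238, 212, 10438, -16676]),
  ([-3, 1, -1], ![9570, -1308, 908, -19204, 13328, 452, 22250, -35578]),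
  ([-3, -1, 1], ![12462, -1710, 1204, -24924, 17338, 590, 29056, -46394]),
  ([-3, -1, -1], ![-4288, 582, -396, 8646, -5978, -201, -9922, 15900]),
  ([2, 2, 1], ![22672, -3104, 2160, -45456, 31568, 1072, 52768, -84336]),
  ([2, -2, 1], ![3025, -414, 287, -6065, 4213, 143, 7038, -11251]),
  ([2, -2, -1], ![6421, -881, 627, -12818, 8927, 303, 14977, -23904]),
  ([2, 1, 2], ![-26368, 3616, -2560, 52704, -36672, -1248, -61472, 98144]),
  ([2, -1, 2], ![2206, -302, 210, -4428, 3074, 104, 5134, -8208]),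
  ([2, 1, -2], ![7958, -1093, 786, -15861, 11056, 377, 18581, -29637]),
  ([2, -1, -2], ![23513, -3221, 2255, -47094, 32727, 1113, 54757, -87484]),
  ([-2, 2, 1], ![-12813, 1755, -1227, 25664, -17835, -606, -29835, 47670]),
  ([-2, 2, -1], ![-20468, 2804, -1964, 40988, -28488, -968, -47668, 76156]),
  ([-2, -2, 1], ![-5477, 750, -523, 10977, -7625, -259, -12750, 20375]),
  ([-2, -2, -1], ![12308, -1686, 1180, -24654, 17132, 582, 28662, -45794]),
  ([-2, 1, 2], ![12622, -1729, 1210, -25281, 17568, 597, 29393, -46961]),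
  ([-2, 1, -2], ![-3065, 420, -295, 6135, -4265, -145, -7140, 11405]),
  ([-2, -1, 2], ![-14047, 1923, -1337, 28170, -19561, -665, -32691, 52252]),
  ([-2, -1, -2], ![-9411, 1290, -909, 18831, -13095, -445, -21930, 35025]),
  ([-1, 3, 1], ![123, -17, 13, -242, 171, 6, 289, -460]),
  ([-1, 3, -1], ![-11820, 1614, -1120, 23726, -16460, -557, -27466, 43926]),
  ([-1, -3, 1], ![6380, -874, 612, -12776, 8880, 302, 14858, -23738]),
  ([-1, -3, -1], ![12610, -1722, 1194, -25312, 17560, 594, 29302, -46862]),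
  ([-1, 2, 2], ![-190, 26, -18, 384, -266, -9, -442, 708]),
  ([-1, 2, -2], ![13726, -1880, 1314, -27494, 19106, 649, 31960, -51066]),
  ([-1, -2, 2], ![-13631, 1867, -1305, 27302, -18973, -644, -31739, 50712]),
  ([-1, -2, -2], ![599, -82, 57, -1203, 835, 28, 1394, -2229]),
  ([-1, 1, 3], ![-3186, 435, -300, 6399, -4438, -150, -7401, 11839]),
  ([-1, 1, -3], ![-2732, 376, -268, 5448, -3798, -130, -6384, 10182]),
  ([-1, -1, 3], ![20431, -2799, 1969, -40888, 28427, 966, 47591, -76018]),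
  ([-1, -1, -3], ![-7808, 1070, -758, 15608, -10858, -369, -18196, 29054])]

/-- The rows for the signed indices of length four. -/
def integralTable4 : List (List ℤ × (Fin 8 → ℤ)) := [
  ([2, 1, 1, 1], ![-13504, 1856, -1344, 26880, -18752, -640, -31552, 50304]),
  ([2, 1, 1, -1], ![-11109, 1518, -1044, 22320, -15477, -523, -25812, 41289]),
  ([2, 1, -1, 1], ![1174, -158, 101, -2395, 1642, 54, 2691, -4333]),
  ([2, 1, -1, -1], ![14927, -2044, 1431, -29899, 20773, 705, 34745, -55518]),
  ([2, -1, 1, 1], ![-2712, 371, -258, 5439, -3777, -128, -6306, 10083]),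
  ([2, -1, 1, -1], ![-14828, 2030, -1419, 29709, -20641, -701, -34517, 55158]),
  ([2, -1, -1, 1], ![-7120, 977, -681, 14262, -9911, -337, -16585, 26496]),
  ([2, -1, -1, -1], ![11204, -1534, 1074, -22440, 15595, 530, 26096, -41691]),
  ([-2, -1, 1, 1], ![8717, -1197, 847, -17415, 12122, 412, 20334, -32456]),
  ([-2, -1, 1, -1], ![-8511, 1162, -806, 17085, -11852, -401, -19775, 31627]),
  ([-2, -1, -1, 1], ![3432, -470, 327, -6882, 4779, 162, 7980, -12759]),
  ([-2, -1, -1, -1], ![-652, 89, -66, 1296, -905, -31, -1531, 2436]),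
  ([-2, 1, -1, 1], ![8659, -1183, 822, -17376, 12059, 409, 20134, -32193]),
  ([-2, 1, 1, -1], ![3571, -490, 344, -7145, 4969, 169, 8322, -13291]),
  ([-1, 2, 1, 1], ![190, -26, 18, -384, 265, 9, 442, -707]),
  ([-1, 2, 1, -1], ![190, -25, 18, -385, 265, 9, 442, -707]),
  ([-1, 2, -1, 1], ![-27776, 3801, -2654, 55667, -38668, -1313, -64648, 103316]),
  ([-1, 2, -1, -1], ![-19006, 2604, -1828, 38048, -26452, -900, -44288, 70740]),
  ([-1, -2, 1, 1], ![-2407, 330, -233, 4812, -3347, -113, -5610, 8957]),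
  ([-1, -2, 1, -1], ![-202, 32, -34, 353, -274, -12, -533, 807]),
  ([-1, -2, -1, 1], ![6507, -893, 631, -13009, 9054, 309, 15184, -24238]),
  ([-1, -2, -1, -1], ![31628, -4333, 3038, -63328, 44021, 1497, 73681, -117702]),
  ([-1, 1, 2, 1], ![-122, 17, -13, 242, -170, -6, -288, 458]),
  ([-1, 1, 2, -1], ![3310, -453, 314, -6641, 4609, 156, 7692, -12301]),
  ([-1, 1, -2, -1], ![6195, -850, 600, -12383, 8619, 294, 14454, -23073]),
  ([-1, 1, -2, 1], ![2888, -394, 272, -5803, 4023, 136, 6706, -10729]),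
  ([-1, -1, 2, 1], ![-7433, 1019, -711, 14888, -10348, -352, -17315, 27663]),
  ([-1, -1, 2, -1], ![6793, -932, 658, -13586, 9453, 322, 15848, -25301]),
  ([-1, -1, -2, 1], ![-313, 43, -30, 626, -437, -15, -730, 1167]),
  ([-1, -1, -2, -1], ![-18914, 2592, -1822, 37855, -26321, -895, -44073, 70394]),
  ([-1, 1, 1, 2], ![191, -26, 18, -384, 267, 9, 442, -709]),
  ([-1, 1, 1, -2], ![-2521, 345, -240, 5054, -3510, -119, -5864, 9374]),
  ([-1, 1, -1, 2], ![13126, -1798, 1257, -26291, 18271, 621, 30567, -48838]),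
  ([-1, -1, 1, 2], ![13312, -1826, 1295, -26595, 18512, 630, 31043, -49555]),
  ([-1, -1, 1, -2], ![-4812, 661, -475, 9593, -6687, -228, -11237, 17924]),
  ([-1, -1, -1, -2], ![-13127, 1798, -1258, 26291, -18271, -621, -30565, 48836])]

/-- The rows for the signed indices of length five. -/
def integralTable5 : List (List ℤ × (Fin 8 → ℤ)) := [
  ([-1, 1, 1, 1, 1], ![-191, 26, -18, 384, -266, -9, -442, 709]),
  ([-1, 1, 1, 1, -1], ![-191, 26, -18, 385, -266, -9, -442, 709]),
  ([-1, 1, 1, -1, 1], ![4481, -614, 430, -8973, 6237, 212, 10438, -16674]),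
  ([-1, 1, 1, -1, -1], ![-1, 0, 0, 0, -1, 0, 0, 2]),
  ([-1, 1, -1, 1, 1], ![-4693, 643, -451, 9395, -6531, -222, -10930, 17462]),
  ([-1, 1, -1, -1, 1], ![-313, 43, -31, 626, -436, -15, -730, 1167]),
  ([-1, 1, -1, -1, -1], ![-13126, 1798, -1258, 26291, -18271, -621, -30565, 48837]),
  ([-1, -1, 1, 1, 1], ![7496, -1031, 747, -14915, 10408, 355, 17522, -27929]),
  ([-1, -1, 1, 1, -1], ![2081, -285, 194, -4183, 2901, 98, 4840, -7740]),
  ([-1, -1, 1, -1, 1], ![-3308, 452, -313, 6641, -4607, -156, -7689, 12297]),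
  ([-1, -1, 1, -1, -1], ![-12121, 1660, -1164, 24269, -16868, -573, -28225, 45094]),
  ([-1, -1, -1, 1, -1], ![12622, -1729, 1210, -25280, 17569, 597, 29393, -46961]),
  ([-1, -1, -1, -1, 1], ![10552, -1445, 1008, -21144, 14690, 499, 24565, -39254])]

/-- All hundred rows. -/
def integralTable : List (List ℤ × (Fin 8 → ℤ)) :=
  integralTableLe2 ++ integralTable3 ++ integralTable4 ++ integralTable5

/-! The relations among Euler sums used here are the regularized double shuffle relations. A product
of two truncated sums has two expansions. The quasi-shuffle expansion is exact at every truncation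
level (`eulerPartial_mul`), because a product of two nested sums splits according to which outermost
variable is larger or whether they agree. The shuffle expansion comes from iterated integrals,
realized as formal power series whose coefficients are the terms of Euler sums (`wordSeries_mul`,
`coeff_wordSeries`). It holds for Cauchy products, hence for truncated sums only up to an error;
`tendsto_mul_sub_cauchyProduct` shows that the error tends to 0 even when one factor diverges.

The estimates use a single scale. Truncated sums grow at most like powers of a logarithm, and `n ^
(1/4)` is a sufficient substitute: terms are `O(n ^ (-3/4))`, and convergent sums approach their
limits at the rate `O(n ^ (-3/4))`. With at most one leading `1`, every divergence is a multiple of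
the harmonic numbers. Comparing the two expansions makes the divergent parts cancel, which leaves
the linear relations of `double_shuffle`.

In weight five there are 108 admissible indices: 100 in the table and 8 for `A, …, H`. The table is
not derived but verified. Let the defect of an index be its Euler sum minus its tabulated value. The
Euler sums satisfy the relations by analysis, the tabulated values satisfy them by integer
arithmetic (`pairConsistent_wordPairs`), so the defects satisfy them too, and the defects of `A, …,
H` vanish. Gaussian elimination finds full rank in the other 100 unknowns (`eliminate_wordPairs`,
`eq_zero_of_eliminate`), so all defects vanish.

The expansion in Zlobin's sums follows by inverting an integer matrix over the rationals. If those
sums were independent and generated everything over the integers, the coefficient `-448/39` in the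
expansion of `eulerSum [3, 1, 1]` would have to be an integer. -/

/-! ### Fourth roots as a comparison scale -/

/-- The fourth root of `n + 1`. -/
noncomputable def fourthRoot (n : ℕ) : ℝ := √√((n : ℝ) + 1)

lemma fourthRoot_pow_four (n : ℕ) : fourthRoot n ^ 4 = (n : ℝ) + 1 := by
  have h : (0 : ℝ) ≤ (n : ℝ) + 1 := by positivity
  rw [fourthRoot, show (4 : ℕ) = 2 * 2 from rfl, pow_mul, Real.sq_sqrt (Real.sqrt_nonneg _),
    Real.sq_sqrt h]

lemma one_le_fourthRoot (n : ℕ) : 1 ≤ fourthRoot n := by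
  simp [fourthRoot, Real.one_le_sqrt]

lemma fourthRoot_pos (n : ℕ) : 0 < fourthRoot n := zero_lt_one.trans_le (one_le_fourthRoot n)

lemma fourthRoot_mono : Monotone fourthRoot := fun m n h => by
  unfold fourthRoot
  gcongr

lemma fourthRoot_succ_le (n : ℕ) : fourthRoot (n + 1) ≤ 2 * fourthRoot n := by
  refine le_of_pow_le_pow_left₀ (n := 4) (by norm_num) (by have := fourthRoot_pos n; positivity) ?_
  rw [mul_pow, fourthRoot_pow_four, fourthRoot_pow_four]
  push_cast
  have : (0 : ℝ) ≤ n := n.cast_nonneg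
  linarith

/-- With `a` and `b` the two roots, `1 = a ^ 4 - b ^ 4` factors as `a - b` times a sum of four cubic
terms, each at most `a ^ 3`. -/
lemma one_le_mul_fourthRoot_sub (n : ℕ) :
    1 ≤ 4 * fourthRoot (n + 1) ^ 3 * (fourthRoot (n + 1) - fourthRoot n) := by
  have h1 := fourthRoot_pow_four n
  have h2 := fourthRoot_pow_four (n + 1)
  have h3 : fourthRoot n ≤ fourthRoot (n + 1) := fourthRoot_mono n.le_succ
  have h4 := fourthRoot_pos n
  push_cast at h2
  set a := fourthRoot (n + 1)
  set b := fourthRoot n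
  have h5 : (a - b) * (a ^ 3 + a ^ 2 * b + a * b ^ 2 + b ^ 3) = 1 := by linear_combination h2 - h1
  have h6 : a ^ 2 * b ≤ a ^ 2 * a := by gcongr
  have ha : 0 < a := h4.trans_le h3
  have h7 : a * b ^ 2 ≤ a * a ^ 2 := by gcongr
  have h8 : b ^ 3 ≤ a ^ 3 := by gcongr
  have h9 : (a - b) * (a ^ 3 + a ^ 2 * b + a * b ^ 2 + b ^ 3) ≤ (a - b) * (4 * a ^ 3) := by
    apply mul_le_mul_of_nonneg_left _ (sub_nonneg.2 h3)
    linarith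
  linarith

/-- A discrete antiderivative of `n ^ (-3/4)`, so that sums of such terms telescope. The constant is
`4 * 2 ^ 3`, the cube coming from `fourthRoot_succ_le`. -/
lemma inv_fourthRoot_pow_three_le (n : ℕ) :
    1 / fourthRoot n ^ 3 ≤ 32 * (fourthRoot (n + 1) - fourthRoot n) := by
  have h1 := one_le_mul_fourthRoot_sub n
  have h2 := fourthRoot_succ_le n
  have h4 := fourthRoot_pos n
  have h5 := fourthRoot_pos (n + 1)
  have h3 : fourthRoot n ≤ fourthRoot (n + 1) := fourthRoot_mono n.le_succ
  rw [div_le_iff₀ (by positivity)]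
  have h6 : fourthRoot (n + 1) ^ 3 ≤ (2 * fourthRoot n) ^ 3 := by gcongr
  have h7 := mul_le_mul_of_nonneg_right h6 (sub_nonneg.2 h3)
  linarith

/-- The same device for `n ^ (-7/4)`, used to bound tails. The constant is `4 * 16`, from `a ^ 4 ≤
16 * b ^ 4`. -/
lemma inv_fourthRoot_pow_seven_le (n : ℕ) :
    1 / fourthRoot n ^ 7 ≤ 64 * (1 / fourthRoot n ^ 3 - 1 / fourthRoot (n + 1) ^ 3) := by
  have h1 := one_le_mul_fourthRoot_sub n
  have h2 := fourthRoot_succ_le n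
  have h4 := fourthRoot_pos n
  have h5 := fourthRoot_pos (n + 1)
  have h3 : fourthRoot n ≤ fourthRoot (n + 1) := fourthRoot_mono n.le_succ
  set a := fourthRoot (n + 1)
  set b := fourthRoot n
  have h6 : a ^ 4 ≤ 16 * b ^ 4 := by
    calc a ^ 4 ≤ (2 * b) ^ 4 := by gcongr
      _ = _ := by ring
  -- The right side exceeds `4 * a ^ 3 * (a - b)` by the nonnegative term shown next.
  have h7 : 1 ≤ 4 * a * (a ^ 3 - b ^ 3) := by
    have : 0 ≤ 4 * a * ((a - b) * (a * b + b ^ 2)) := by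
      have := sub_nonneg.2 h3
      positivity
    linarith
  have h8 : a ^ 3 ≤ 64 * b ^ 4 * (a ^ 3 - b ^ 3) := by
    have h9 : 0 ≤ a ^ 3 - b ^ 3 := sub_nonneg.2 (by gcongr)
    calc a ^ 3 ≤ a ^ 3 * (4 * a * (a ^ 3 - b ^ 3)) := le_mul_of_one_le_right (by positivity) h7
      _ = 4 * (a ^ 4 * (a ^ 3 - b ^ 3)) := by ring
      _ ≤ 4 * ((16 * b ^ 4) * (a ^ 3 - b ^ 3)) := by gcongr
      _ = _ := by ring
  rw [div_sub_div _ _ (by positivity) (by positivity), ← mul_div_assoc,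
    div_le_div_iff₀ (by positivity) (by positivity)]
  nlinarith [pow_pos h4 3]

lemma tendsto_const_div_fourthRoot_pow (C : ℝ) {m : ℕ} (hm : m ≠ 0) :
    Tendsto (fun n => C / fourthRoot n ^ m) atTop (𝓝 0) := by
  refine Tendsto.const_div_atTop ((tendsto_pow_atTop hm).comp ?_) C
  unfold fourthRoot
  refine Real.tendsto_sqrt_atTop.comp (Real.tendsto_sqrt_atTop.comp ?_)
  exact tendsto_atTop_add_const_right _ _ tendsto_natCast_atTop_atTop

lemma sum_inv_fourthRoot_le (n : ℕ) :
    ∑ k ∈ Finset.range n, 1 / fourthRoot k ^ 3 ≤ 32 * fourthRoot n := by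
  calc ∑ k ∈ Finset.range n, 1 / fourthRoot k ^ 3
      ≤ ∑ k ∈ Finset.range n, 32 * (fourthRoot (k + 1) - fourthRoot k) :=
        Finset.sum_le_sum fun k _ => inv_fourthRoot_pow_three_le k
    _ = 32 * (fourthRoot n - fourthRoot 0) := by rw [← Finset.mul_sum, Finset.sum_range_sub]
    _ ≤ _ := by linarith [fourthRoot_pos 0]

/-- A sequence whose increments are `O(n ^ (-7/4))` converges at the rate `O(n ^ (-3/4))`. -/
lemma exists_limit_of_abs_sub_le {f : ℕ → ℝ} {C : ℝ}
    (h : ∀ n, |f (n + 1) - f n| ≤ C / fourthRoot n ^ 7) :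
    ∃ L, ∀ n, |f n - L| ≤ 64 * C / fourthRoot n ^ 3 := by
  have hC : 0 ≤ C := by
    have := (abs_nonneg _).trans (h 0)
    by_contra hc
    exact absurd this (not_le.2 (div_neg_of_neg_of_pos (not_le.1 hc)
      (pow_pos (fourthRoot_pos 0) _)))
  set g : ℕ → ℝ := fun n => 64 * C / fourthRoot n ^ 3
  have hg : ∀ n, 0 ≤ g n := fun n => by have := fourthRoot_pos n; positivity
  -- Each increment is at most the decrease of `g`; keeping `g (n + k)` on the right lets the bounds
  -- telescope.
  have key : ∀ n k, |f (n + k) - f n| ≤ g n - g (n + k) := by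
    intro n k
    induction k with
    | zero => simp
    | succ k ih =>
      have h1 := h (n + k)
      have h2 := mul_le_mul_of_nonneg_left (inv_fourthRoot_pow_seven_le (n + k)) hC
      have h3 : f (n + (k + 1)) - f n = (f (n + k + 1) - f (n + k)) + (f (n + k) - f n) := by
        rw [add_assoc]; ring
      rw [h3]
      refine (abs_add_le _ _).trans ((add_le_add h1 ih).trans ?_)
      simp only [g]
      rw [← add_assoc]
      rw [div_eq_mul_one_div] at *
      have h4 : ∀ m, 64 * C / fourthRoot m ^ 3 = 64 * C * (1 / fourthRoot m ^ 3) := fun m => by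
        ring
      rw [h4, h4, h4]
      linarith
  have key' : ∀ n m, n ≤ m → |f m - f n| ≤ g n := by
    intro n m hnm
    obtain ⟨k, rfl⟩ := Nat.exists_eq_add_of_le hnm
    linarith [key n k, hg (n + k)]
  have hcau : CauchySeq f := by
    refine cauchySeq_of_le_tendsto_0 (fun n => 2 * g n) (fun n m N hn hm => ?_) ?_
    · have := abs_sub_le (f n) (f N) (f m)
      rw [Real.dist_eq]
      have h1 := key' N n hn
      have h2 := key' N m hm
      rw [abs_sub_comm] at h2
      linarith
    · simpa using (tendsto_const_div_fourthRoot_pow (64 * C) three_ne_zero).const_mul 2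
  obtain ⟨L, hL⟩ := cauchySeq_tendsto_of_complete hcau
  refine ⟨L, fun n => ?_⟩
  rw [abs_sub_comm]
  refine le_of_tendsto (hL.sub_const (f n)).abs ?_
  filter_upwards [eventually_ge_atTop n] with m hm using key' n m hm

/-! ### Growth and convergence of truncated sums -/

lemma eulerPartial_zero (s : ℤ) (t : List ℤ) : eulerPartial (s :: t) 0 = 0 := by
  simp [eulerPartial]

lemma eulerPartial_succ (s : ℤ) (t : List ℤ) (n : ℕ) :
    eulerPartial (s :: t) (n + 1) = eulerPartial (s :: t) n +
      (s.sign : ℝ) ^ (n + 1) / ((n : ℝ) + 1) ^ s.natAbs * eulerPartial t n := by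
  simp [eulerPartial, Finset.sum_range_succ]

lemma abs_sign_pow {s : ℤ} (hs : s ≠ 0) (n : ℕ) : |(s.sign : ℝ) ^ n| = 1 := by
  rw [abs_pow]
  rcases lt_or_gt_of_ne hs with h | h
  · simp [Int.sign_eq_neg_one_of_neg h]
  · simp [Int.sign_eq_one_of_pos h]

lemma abs_eulerPartial_succ_sub {s : ℤ} (hs : s ≠ 0) (t : List ℤ) (n : ℕ) :
    |eulerPartial (s :: t) (n + 1) - eulerPartial (s :: t) n| =
      |eulerPartial t n| / ((n : ℝ) + 1) ^ s.natAbs := by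
  have : (0 : ℝ) < (n : ℝ) + 1 := by positivity
  rw [eulerPartial_succ, add_sub_cancel_left, abs_mul, abs_div, abs_sign_pow hs,
    abs_of_pos (pow_pos this _)]
  ring

/-- The truncated sums grow at most like `n ^ (1/4)`. -/
lemma exists_abs_eulerPartial_le {s : List ℤ} (hs : ∀ x ∈ s, x ≠ 0) :
    ∃ C, 0 ≤ C ∧ ∀ n, |eulerPartial s n| ≤ C * fourthRoot n := by
  induction s with
  | nil => exact ⟨1, zero_le_one, fun n => by simpa [eulerPartial] using one_le_fourthRoot n⟩
  | cons a t ih =>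
    obtain ⟨C, hC, h⟩ := ih fun x hx => hs x (List.mem_cons_of_mem _ hx)
    have ha : a ≠ 0 := hs a List.mem_cons_self
    -- Increments are at most `C / fourthRoot n ^ 3`, which telescopes at the cost of the factor 32.
    refine ⟨C * 32, by positivity, fun n => ?_⟩
    induction n with
    | zero =>
      rw [eulerPartial_zero, abs_zero]
      have := fourthRoot_pos 0
      positivity
    | succ n ihn =>
      have h1 := abs_eulerPartial_succ_sub ha t n
      have h2 : |eulerPartial t n| / ((n : ℝ) + 1) ^ a.natAbs ≤ C * (1 / fourthRoot n ^ 3) := by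
        have hq := fourthRoot_pos n
        calc |eulerPartial t n| / ((n : ℝ) + 1) ^ a.natAbs
            ≤ C * fourthRoot n / ((n : ℝ) + 1) ^ 1 := by
              gcongr
              · exact h n
              · have : (0 : ℝ) ≤ n := n.cast_nonneg
                linarith
              · exact Int.natAbs_pos.2 ha
          _ = _ := by
              rw [pow_one, ← fourthRoot_pow_four]
              field_simp
      have h3 := mul_le_mul_of_nonneg_left (inv_fourthRoot_pow_three_le n) hC
      have h4 := abs_sub_abs_le_abs_sub (eulerPartial (a :: t) (n + 1)) (eulerPartial (a :: t) n)
      linarith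

lemma exists_abs_eulerPartial_sub_le {a : ℤ} {t : List ℤ} (hs : ∀ x ∈ a :: t, x ≠ 0) :
    ∃ C, 0 ≤ C ∧ ∀ n, |eulerPartial (a :: t) (n + 1) - eulerPartial (a :: t) n| ≤
      C * fourthRoot n / ((n : ℝ) + 1) ^ a.natAbs := by
  obtain ⟨C, hC, h⟩ := exists_abs_eulerPartial_le fun x hx => hs x (List.mem_cons_of_mem a hx)
  refine ⟨C, hC, fun n => ?_⟩
  rw [abs_eulerPartial_succ_sub (hs a List.mem_cons_self)]
  gcongr
  exact h n

lemma exists_abs_eulerPartial_sub_le_inv {s : List ℤ} (hs : ∀ x ∈ s, x ≠ 0) :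
    ∃ C, 0 ≤ C ∧ ∀ n, |eulerPartial s (n + 1) - eulerPartial s n| ≤ C / fourthRoot n ^ 3 := by
  cases s with
  | nil => exact ⟨0, le_rfl, fun n => by simp [eulerPartial]⟩
  | cons a t =>
    obtain ⟨C, hC, h⟩ := exists_abs_eulerPartial_sub_le hs
    refine ⟨C, hC, fun n => (h n).trans ?_⟩
    have hq := fourthRoot_pos n
    calc C * fourthRoot n / ((n : ℝ) + 1) ^ a.natAbs ≤ C * fourthRoot n / ((n : ℝ) + 1) ^ 1 := by
          gcongr
          · have : (0 : ℝ) ≤ n := n.cast_nonneg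
            linarith
          · exact Int.natAbs_pos.2 (hs a List.mem_cons_self)
      _ = C / fourthRoot n ^ 3 := by
          rw [pow_one, ← fourthRoot_pow_four]
          field_simp

/-- A first entry of absolute value at least 2 gives increments `O(n ^ (1/4 - 2))`, which are
summable with the required tail. For a first entry `-1` the increments alternate in sign, and the
sum of two consecutive truncated sums has increments of that same order. -/
lemma exists_rate {s : List ℤ} (hs : IsEulerIndex s) :
    ∃ L C, 0 ≤ C ∧ ∀ n, |eulerPartial s n - L| ≤ C / fourthRoot n ^ 3 := by
  obtain ⟨h0, h1⟩ := hs
  cases s with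
  | nil => exact ⟨1, 0, le_rfl, fun n => by simp [eulerPartial]⟩
  | cons a t =>
    have ha : a ≠ 0 := h0 a List.mem_cons_self
    have ha1 : a ≠ 1 := by simpa using h1
    have ht : ∀ x ∈ t, x ≠ 0 := fun x hx => h0 x (List.mem_cons_of_mem a hx)
    by_cases h2 : 2 ≤ a.natAbs
    · obtain ⟨C, hC, h⟩ := exists_abs_eulerPartial_sub_le h0
      obtain ⟨L, hL⟩ := exists_limit_of_abs_sub_le (f := eulerPartial (a :: t)) (C := C)
        fun n => (h n).trans (by
          have hq := fourthRoot_pos n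
          calc C * fourthRoot n / ((n : ℝ) + 1) ^ a.natAbs
              ≤ C * fourthRoot n / ((n : ℝ) + 1) ^ 2 := by
                gcongr
                have : (0 : ℝ) ≤ n := n.cast_nonneg
                linarith
            _ = C / fourthRoot n ^ 7 := by
                rw [← fourthRoot_pow_four]
                field_simp)
      exact ⟨L, 64 * C, by positivity, hL⟩
    · obtain rfl : a = -1 := by omega
      obtain ⟨C, hC, h⟩ := exists_abs_eulerPartial_le ht
      obtain ⟨D, hD, hd⟩ := exists_abs_eulerPartial_sub_le_inv ht
      obtain ⟨E, hE, he⟩ := exists_abs_eulerPartial_sub_le_inv h0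
      set e := eulerPartial (-1 :: t)
      have hsucc : ∀ n : ℕ, e (n + 1) = e n + (-1) ^ (n + 1) * (eulerPartial t n / ((n : ℝ) + 1)) := by
        intro n
        simp only [e]
        rw [eulerPartial_succ]
        simp
        ring
      -- Summation by parts: `D` controls the variation of the inner sum, and `C` its size against
      -- the difference of `1 / (n + 1)` and `1 / (n + 2)`.
      obtain ⟨L, hL⟩ := exists_limit_of_abs_sub_le (f := fun n => e (n + 1) + e n) (C := D + C)
        fun n => by
          have hq := fourthRoot_pos n
          have hn : (0 : ℝ) < (n : ℝ) + 1 := by positivity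
          have h3 : e (n + 1 + 1) + e (n + 1) - (e (n + 1) + e n) = (-1) ^ n *
              ((eulerPartial t (n + 1) - eulerPartial t n) / ((n : ℝ) + 2) -
                eulerPartial t n / (((n : ℝ) + 1) * ((n : ℝ) + 2))) := by
            rw [hsucc (n + 1), hsucc n]
            push_cast
            have : (n : ℝ) + 2 ≠ 0 := by positivity
            have : (n : ℝ) + 1 + 1 ≠ 0 := by positivity
            field_simp
            ring
          rw [h3, abs_mul, abs_pow, abs_neg, abs_one, one_pow, one_mul]
          refine (abs_sub _ _).trans ?_
          rw [abs_div, abs_div, abs_of_pos (show (0 : ℝ) < n + 2 by positivity),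
            abs_of_pos (show (0 : ℝ) < (n + 1) * (n + 2) by positivity), add_div]
          apply add_le_add
          · calc |eulerPartial t (n + 1) - eulerPartial t n| / ((n : ℝ) + 2)
                ≤ (D / fourthRoot n ^ 3) / ((n : ℝ) + 1) := by
                  gcongr
                  · exact hd n
                  · norm_num
              _ = _ := by
                  rw [← fourthRoot_pow_four]
                  field_simp
          · calc |eulerPartial t n| / (((n : ℝ) + 1) * ((n : ℝ) + 2))
                ≤ (C * fourthRoot n) / (((n : ℝ) + 1) * ((n : ℝ) + 1)) := by
                  gcongr
                  · exact h n
                  · norm_num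
              _ = _ := by
                  rw [← fourthRoot_pow_four]
                  field_simp
      -- A single truncated sum is half of the consecutive sum minus half of one increment, and the
      -- increment is bounded through `E`.
      refine ⟨L / 2, (64 * (D + C) + E) / 2, by positivity, fun n => ?_⟩
      have h4 := hL n
      have h5 := he n
      have h6 : e n - L / 2 = ((e (n + 1) + e n - L) - (e (n + 1) - e n)) / 2 := by ring
      rw [h6, abs_div, abs_of_pos (zero_lt_two' ℝ)]
      have h7 := (abs_sub (e (n + 1) + e n - L) (e (n + 1) - e n)).trans (add_le_add h4 h5)
      calc _ ≤ (64 * (D + C) / fourthRoot n ^ 3 + E / fourthRoot n ^ 3) / 2 := by gcongr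
        _ = _ := by ring

/-- The defining limits of the Euler sums exist, with a rate of convergence. -/
theorem exists_abs_eulerPartial_sub_eulerSum_le {s : List ℤ} (hs : IsEulerIndex s) :
    ∃ C, 0 ≤ C ∧ ∀ n, |eulerPartial s n - eulerSum s| ≤ C / fourthRoot n ^ 3 := by
  obtain ⟨L, C, hC, h⟩ := exists_rate hs
  have hL : Tendsto (eulerPartial s) atTop (𝓝 L) := by
    rw [tendsto_iff_norm_sub_tendsto_zero]
    exact squeeze_zero (fun _ => norm_nonneg _) h
      (tendsto_const_div_fourthRoot_pow C three_ne_zero)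
  rw [eulerSum, hL.limUnder_eq]
  exact ⟨C, hC, h⟩

theorem tendsto_eulerPartial {s : List ℤ} (hs : IsEulerIndex s) :
    Tendsto (eulerPartial s) atTop (𝓝 (eulerSum s)) := by
  obtain ⟨C, -, h⟩ := exists_abs_eulerPartial_sub_eulerSum_le hs
  rw [tendsto_iff_norm_sub_tendsto_zero]
  exact squeeze_zero (fun _ => norm_nonneg _) h
    (tendsto_const_div_fourthRoot_pow C three_ne_zero)

/-! ### Quasi-shuffle and shuffle products -/

/-- The index entry of a product of two factors with the same summation variable. -/
def mergeEntry (a b : ℤ) : ℤ := a.sign * b.sign * (a.natAbs + b.natAbs)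

/-- The recursion of the quasi-shuffle product in its second argument. -/
def stuffleStep (a : ℤ) (f : List ℤ → List (List ℤ)) : List ℤ → List (List ℤ)
  | [] => (f []).map (a :: ·)
  | b :: v => (f (b :: v)).map (a :: ·) ++
      ((stuffleStep a f v).map (b :: ·) ++ (f v).map (mergeEntry a b :: ·))

/-- The quasi-shuffle product of two signed indices, as a list with multiplicities. -/
def stuffle : List ℤ → List ℤ → List (List ℤ)
  | [] => fun v => [v]
  | a :: u => stuffleStep a (stuffle u)

/-- The recursion of the shuffle product in its second argument. -/
def shuffleStep (a : ℤ) (f : List ℤ → List (List ℤ)) : List ℤ → List (List ℤ)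
  | [] => (f []).map (a :: ·)
  | b :: v => (f (b :: v)).map (a :: ·) ++ (shuffleStep a f v).map (b :: ·)

/-- The shuffle product of two words, as a list with multiplicities. -/
def shuffle : List ℤ → List ℤ → List (List ℤ)
  | [] => fun v => [v]
  | a :: u => shuffleStep a (shuffle u)

lemma stuffle_cons_cons (a b : ℤ) (u v : List ℤ) :
    stuffle (a :: u) (b :: v) = (stuffle u (b :: v)).map (a :: ·) ++
      ((stuffle (a :: u) v).map (b :: ·) ++ (stuffle u v).map (mergeEntry a b :: ·)) := rfl

lemma shuffle_cons_cons (a b : ℤ) (u v : List ℤ) :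
    shuffle (a :: u) (b :: v) =
      (shuffle u (b :: v)).map (a :: ·) ++ (shuffle (a :: u) v).map (b :: ·) := rfl

lemma stuffle_nil_right (u : List ℤ) : stuffle u [] = [u] := by
  induction u with
  | nil => rfl
  | cons a u ih => simp [stuffle, stuffleStep, ih]

lemma shuffle_nil_right (u : List ℤ) : shuffle u [] = [u] := by
  induction u with
  | nil => rfl
  | cons a u ih => simp [shuffle, shuffleStep, ih]

lemma mergeEntry_ne_zero {a b : ℤ} (ha : a ≠ 0) (hb : b ≠ 0) : mergeEntry a b ≠ 0 := by
  have h := Int.natAbs_pos.2 ha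
  refine mul_ne_zero (mul_ne_zero ?_ ?_) (by omega)
  · rwa [Ne, Int.sign_eq_zero_iff_zero]
  · rwa [Ne, Int.sign_eq_zero_iff_zero]

lemma ne_zero_of_mem_stuffle {u v w : List ℤ} (hu : ∀ x ∈ u, x ≠ 0) (hv : ∀ x ∈ v, x ≠ 0)
    (hw : w ∈ stuffle u v) : ∀ x ∈ w, x ≠ 0 := by
  induction u generalizing v w with
  | nil => rwa [List.mem_singleton.1 hw]
  | cons a u ihu =>
    induction v generalizing w with
    | nil =>
      rw [stuffle_nil_right] at hw
      rwa [List.mem_singleton.1 hw]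
    | cons b v ihv =>
      rw [List.forall_mem_cons] at hu hv
      rw [stuffle_cons_cons, List.mem_append, List.mem_append, List.mem_map, List.mem_map,
        List.mem_map] at hw
      rcases hw with ⟨w, hw, rfl⟩ | ⟨w, hw, rfl⟩ | ⟨w, hw, rfl⟩ <;> rw [List.forall_mem_cons]
      · exact ⟨hu.1, ihu hu.2 (List.forall_mem_cons.2 hv) hw⟩
      · exact ⟨hv.1, ihv hv.2 hw⟩
      · exact ⟨mergeEntry_ne_zero hu.1 hv.1, ihu hu.2 hv.2 hw⟩

lemma sum_eulerPartial_cons_succ (a : ℤ) (l : List (List ℤ)) (n : ℕ) :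
    ((l.map (a :: ·)).map (eulerPartial · (n + 1))).sum =
      ((l.map (a :: ·)).map (eulerPartial · n)).sum +
        (a.sign : ℝ) ^ (n + 1) / ((n : ℝ) + 1) ^ a.natAbs * (l.map (eulerPartial · n)).sum := by
  induction l with
  | nil => simp
  | cons w l ih =>
    simp only [List.map_cons, List.sum_cons] at ih ⊢
    rw [ih, eulerPartial_succ]
    ring

lemma sum_eulerPartial_cons_zero (a : ℤ) (l : List (List ℤ)) :
    ((l.map (a :: ·)).map (eulerPartial · 0)).sum = 0 := by
  induction l with
  | nil => simp
  | cons w l ih => simpa [eulerPartial_zero] using ih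

lemma mergeEntry_coeff {a b : ℤ} (ha : a ≠ 0) (hb : b ≠ 0) (n : ℕ) :
    ((mergeEntry a b).sign : ℝ) ^ (n + 1) / ((n : ℝ) + 1) ^ (mergeEntry a b).natAbs =
      (a.sign : ℝ) ^ (n + 1) / ((n : ℝ) + 1) ^ a.natAbs *
        ((b.sign : ℝ) ^ (n + 1) / ((n : ℝ) + 1) ^ b.natAbs) := by
  have h1 : (mergeEntry a b).sign = a.sign * b.sign := by
    have : ((a.natAbs : ℤ) + b.natAbs).sign = 1 := by
      apply Int.sign_eq_one_of_pos
      have := Int.natAbs_pos.2 ha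
      omega
    rw [mergeEntry, Int.sign_mul, Int.sign_mul, this, Int.sign_sign, Int.sign_sign, mul_one]
  have h2 : (mergeEntry a b).natAbs = a.natAbs + b.natAbs := by
    rw [mergeEntry, Int.natAbs_mul, Int.natAbs_mul, Int.natAbs_sign_of_ne_zero ha,
      Int.natAbs_sign_of_ne_zero hb, one_mul, one_mul]
    omega
  rw [h1, h2]
  push_cast
  rw [mul_pow, pow_add]
  ring

/-- The quasi-shuffle product formula for truncated sums. -/
theorem eulerPartial_mul {u v : List ℤ} (hu : ∀ x ∈ u, x ≠ 0) (hv : ∀ x ∈ v, x ≠ 0) (n : ℕ) :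
    eulerPartial u n * eulerPartial v n = ((stuffle u v).map (eulerPartial · n)).sum := by
  induction u generalizing v n with
  | nil => simp [stuffle, eulerPartial]
  | cons a u ihu =>
    have ha := hu a List.mem_cons_self
    have hu' : ∀ x ∈ u, x ≠ 0 := fun x hx => hu x (List.mem_cons_of_mem _ hx)
    induction v generalizing n with
    | nil => simp [stuffle_nil_right, eulerPartial]
    | cons b v ihv =>
      have hb := hv b List.mem_cons_self
      have hv' : ∀ x ∈ v, x ≠ 0 := fun x hx => hv x (List.mem_cons_of_mem _ hx)
      induction n with
      | zero =>
        rw [stuffle_cons_cons, eulerPartial_zero, zero_mul]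
        simp only [List.map_append, List.sum_append, sum_eulerPartial_cons_zero, add_zero]
      | succ n ihn =>
        have h1 := ihu hu' hv n
        have h2 := ihv hv' n
        have h3 := ihu hu' hv' n
        rw [stuffle_cons_cons] at ihn ⊢
        simp only [List.map_append, List.sum_append, sum_eulerPartial_cons_succ] at ihn ⊢
        -- Discrete Leibniz rule: the increment of the product has two mixed terms and a product of
        -- increments, matching the three branches of the recursion.
        rw [← h1, ← h2, ← h3, mergeEntry_coeff ha hb, eulerPartial_succ, eulerPartial_succ]
        linear_combination ihn

/-! ### Iterated integrals as formal power series -/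

/-- The power series of the differential form `z * d (log (1 / (1 - a * z))) / dz`, and `1` for
the letter `0`. -/
noncomputable def letterSeries (a : ℤ) : PowerSeries ℝ :=
  if a = 0 then 1 else PowerSeries.mk fun n => if n = 0 then 0 else (a : ℝ) ^ n

/-- The iterated integral of a word, as a power series. -/
noncomputable def wordSeries : List ℤ → PowerSeries ℝ
  | [] => 1
  | a :: w => PowerSeries.mk fun n => PowerSeries.coeff n (letterSeries a * wordSeries w) / n

/-- The operator `z * d / dz`. -/
noncomputable def eulerOp (f : PowerSeries ℝ) : PowerSeries ℝ :=
  PowerSeries.X * PowerSeries.derivative ℝ f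

lemma coeff_eulerOp (f : PowerSeries ℝ) (n : ℕ) :
    PowerSeries.coeff n (eulerOp f) = n * PowerSeries.coeff n f := by
  cases n with
  | zero => simp [eulerOp]
  | succ n =>
    rw [eulerOp, PowerSeries.coeff_succ_X_mul, PowerSeries.coeff_derivative]
    push_cast
    ring

lemma eulerOp_mul (f g : PowerSeries ℝ) : eulerOp (f * g) = eulerOp f * g + f * eulerOp g := by
  simp only [eulerOp, Derivation.leibniz, smul_eq_mul]
  ring

lemma eulerOp_add (f g : PowerSeries ℝ) : eulerOp (f + g) = eulerOp f + eulerOp g := by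
  simp only [eulerOp, map_add, mul_add]

lemma eq_of_eulerOp_eq {f g : PowerSeries ℝ} (h : eulerOp f = eulerOp g)
    (h0 : PowerSeries.coeff 0 f = PowerSeries.coeff 0 g) : f = g := by
  ext n
  cases n with
  | zero => exact h0
  | succ n =>
    have := congrArg (PowerSeries.coeff (n + 1)) h
    rw [coeff_eulerOp, coeff_eulerOp] at this
    exact mul_left_cancel₀ (by positivity) this

/-- Words that do not end with the letter `0`. -/
def GoodWord : List ℤ → Prop
  | [] => True
  | a :: w => (w = [] → a ≠ 0) ∧ GoodWord w

/-- Division by `n = 0` returns 0, which plays the role of the constant of integration. -/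
lemma coeff_zero_wordSeries_cons (a : ℤ) (w : List ℤ) :
    PowerSeries.coeff 0 (wordSeries (a :: w)) = 0 := by
  simp [wordSeries]

/-- Dividing by `n = 0` destroys a constant term, so `eulerOp` can undo the integration only when
there is none. The single bad case is the letter `0` before the empty word, where the integral would
be a logarithm. -/
lemma coeff_zero_letterSeries_mul {a : ℤ} {w : List ℤ} (h : w = [] → a ≠ 0) :
    PowerSeries.coeff 0 (letterSeries a * wordSeries w) = 0 := by
  by_cases ha : a = 0
  · cases w with
    | nil => exact absurd ha (h rfl)
    | cons b w => rw [letterSeries, if_pos ha, one_mul, coeff_zero_wordSeries_cons]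
  · simp [PowerSeries.coeff_mul, letterSeries, ha]

lemma eulerOp_wordSeries_cons {a : ℤ} {w : List ℤ} (h : w = [] → a ≠ 0) :
    eulerOp (wordSeries (a :: w)) = letterSeries a * wordSeries w := by
  ext n
  rw [coeff_eulerOp]
  cases n with
  | zero => rw [coeff_zero_letterSeries_mul h]; simp
  | succ n =>
    rw [wordSeries, PowerSeries.coeff_mk]
    field_simp

lemma ne_nil_of_mem_shuffle {u v w : List ℤ} (h : u ≠ [] ∨ v ≠ []) (hw : w ∈ shuffle u v) :
    w ≠ [] := by
  rintro rfl
  cases u with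
  | nil => simp_all [shuffle]
  | cons a u =>
    cases v with
    | nil => simp [shuffle_nil_right] at hw
    | cons b v => simp [shuffle_cons_cons] at hw

lemma eulerOp_sum_wordSeries_cons (a : ℤ) {l : List (List ℤ)} (h : ∀ w ∈ l, w ≠ []) :
    eulerOp ((l.map (a :: ·)).map wordSeries).sum = letterSeries a * (l.map wordSeries).sum := by
  induction l with
  | nil => simp [eulerOp]
  | cons w l ih =>
    simp only [List.map_cons, List.sum_cons, eulerOp_add]
    rw [ih fun w hw => h w (List.mem_cons_of_mem _ hw),
      eulerOp_wordSeries_cons fun hw => absurd hw (h w List.mem_cons_self)]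
    ring

lemma coeff_zero_sum_wordSeries_cons (a : ℤ) (l : List (List ℤ)) :
    PowerSeries.coeff 0 ((l.map (a :: ·)).map wordSeries).sum = 0 := by
  induction l with
  | nil => simp
  | cons w l ih =>
    simp only [List.map_cons, List.sum_cons, map_add] at ih ⊢
    rw [ih, coeff_zero_wordSeries_cons, add_zero]

/-- The shuffle product formula for iterated integrals. -/
theorem wordSeries_mul {u v : List ℤ} (hu : GoodWord u) (hv : GoodWord v) :
    wordSeries u * wordSeries v = ((shuffle u v).map wordSeries).sum := by
  induction u generalizing v with
  | nil => simp [shuffle, wordSeries]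
  | cons a u ihu =>
    induction v with
    | nil => simp [shuffle_nil_right, wordSeries]
    | cons b v ihv =>
      -- The Leibniz rule for `z * d / dz` removes the first letter of either factor, which is the
      -- shuffle recursion; both sides have zero constant term.
      apply eq_of_eulerOp_eq
      · rw [eulerOp_mul, eulerOp_wordSeries_cons hu.1, eulerOp_wordSeries_cons hv.1,
          shuffle_cons_cons, List.map_append, List.sum_append, eulerOp_add,
          eulerOp_sum_wordSeries_cons _ fun w => ne_nil_of_mem_shuffle (Or.inr (by simp)),
          eulerOp_sum_wordSeries_cons _ fun w => ne_nil_of_mem_shuffle (Or.inl (by simp)),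
          ← ihu hu.2 hv, ← ihv hv.2]
        ring
      · rw [shuffle_cons_cons, List.map_append, List.sum_append, map_add,
          coeff_zero_sum_wordSeries_cons, coeff_zero_sum_wordSeries_cons,
          PowerSeries.coeff_mul]
        simp [wordSeries]

/-! ### From words to signed indices -/

/-- Raise the absolute value of the first entry by one. -/
def bumpHead : List ℤ → List ℤ
  | [] => []
  | a :: t => (a + a.sign) :: t

/-- The signed index of a word in the letters `0, 1, -1`; here `e` is the preceding nonzero
letter. -/
def decodeWord : ℤ → List ℤ → List ℤ
  | _, [] => []
  | e, a :: w => if a = 0 then bumpHead (decodeWord e w) else (e * a) :: decodeWord a w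

/-- The summand of `eulerPartial` whose outermost variable is `n`. -/
noncomputable def eulerTerm : List ℤ → ℕ → ℝ
  | [], n => if n = 0 then 1 else 0
  | _ :: _, 0 => 0
  | a :: t, n + 1 => (a.sign : ℝ) ^ (n + 1) / ((n : ℝ) + 1) ^ a.natAbs * eulerPartial t n

/-- The argument of `eulerTerm` is the true outermost variable, while the range in `eulerPartial` is
shifted by one; hence `n + 1` on the left. -/
lemma sum_eulerTerm (s : List ℤ) (n : ℕ) :
    ∑ k ∈ Finset.range (n + 1), eulerTerm s k = eulerPartial s n := by
  cases s with
  | nil => simp [eulerTerm, eulerPartial]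
  | cons a t =>
    rw [Finset.sum_range_succ']
    simp [eulerTerm, eulerPartial]

lemma decodeWord_ne_nil {w : List ℤ} (h : w ≠ []) (hg : GoodWord w) (e : ℤ) :
    decodeWord e w ≠ [] := by
  induction w generalizing e with
  | nil => exact absurd rfl h
  | cons a w ih =>
    rw [decodeWord]
    split_ifs with ha
    · have h1 : w ≠ [] := fun hw => hg.1 hw ha
      have h2 := ih h1 hg.2 e
      cases hd : decodeWord e w with
      | nil => exact absurd hd h2
      | cons b t => simp [bumpHead]
    · simp

lemma decodeWord_entries {w : List ℤ} (hl : ∀ x ∈ w, x = 0 ∨ x = 1 ∨ x = -1) {e : ℤ}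
    (he : e = 1 ∨ e = -1) : ∀ x ∈ decodeWord e w, x ≠ 0 := by
  induction w generalizing e with
  | nil => simp [decodeWord]
  | cons a w ih =>
    have hl' := fun x hx => hl x (List.mem_cons_of_mem a hx)
    rw [decodeWord]
    split_ifs with ha
    · have := ih hl' he
      cases hd : decodeWord e w with
      | nil => simp [bumpHead]
      | cons b t =>
        rw [hd] at this
        intro x hx
        rcases List.mem_cons.1 hx with rfl | hx
        · have hb : b ≠ 0 := this b List.mem_cons_self
          rcases lt_or_gt_of_ne hb with h | h
          · rw [Int.sign_eq_neg_one_of_neg h]; omega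
          · rw [Int.sign_eq_one_of_pos h]; omega
        · exact this x (List.mem_cons_of_mem _ hx)
    · have ha' : a = 1 ∨ a = -1 := (hl a List.mem_cons_self).resolve_left ha
      intro x hx
      rcases List.mem_cons.1 hx with rfl | hx
      · rcases he with rfl | rfl <;> simpa using ha
      · exact ih hl' ha' x hx

lemma eulerTerm_bumpHead {a : ℤ} (ha : a ≠ 0) (t : List ℤ) (n : ℕ) :
    eulerTerm (bumpHead (a :: t)) n = eulerTerm (a :: t) n / n := by
  cases n with
  | zero => simp [eulerTerm, bumpHead]
  | succ n =>
    have h1 : (a + a.sign).sign = a.sign ∧ (a + a.sign).natAbs = a.natAbs + 1 := by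
      rcases lt_or_gt_of_ne ha with h | h
      · rw [Int.sign_eq_neg_one_of_neg h]
        exact ⟨Int.sign_eq_neg_one_of_neg (by omega), by omega⟩
      · rw [Int.sign_eq_one_of_pos h]
        exact ⟨Int.sign_eq_one_of_pos (by omega), by omega⟩
    rw [bumpHead, eulerTerm, eulerTerm, h1.1, h1.2, pow_succ]
    push_cast
    field_simp
    ring

/-- The coefficients of the iterated integral of a word are the summands of an Euler sum. -/
theorem coeff_wordSeries {w : List ℤ} (hl : ∀ x ∈ w, x = 0 ∨ x = 1 ∨ x = -1) (hg : GoodWord w)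
    {e : ℤ} (he : e = 1 ∨ e = -1) (n : ℕ) :
    PowerSeries.coeff n (wordSeries w) = (e : ℝ) ^ n * eulerTerm (decodeWord e w) n := by
  induction w generalizing e n with
  | nil =>
    rw [wordSeries, decodeWord, eulerTerm, PowerSeries.coeff_one]
    split_ifs with h <;> simp [h]
  | cons a w ih =>
    have hl' := fun x hx => hl x (List.mem_cons_of_mem a hx)
    rw [wordSeries, PowerSeries.coeff_mk, decodeWord]
    by_cases ha : a = 0
    · rw [if_pos ha, letterSeries, if_pos ha, one_mul, ih hl' hg.2 he]
      have h1 := decodeWord_ne_nil (fun hw => hg.1 hw ha) hg.2 e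
      have h2 := decodeWord_entries hl' he
      cases hd : decodeWord e w with
      | nil => exact absurd hd h1
      | cons b t =>
        rw [eulerTerm_bumpHead (h2 b (by rw [hd]; exact List.mem_cons_self))]
        ring
    · have ha' : a = 1 ∨ a = -1 := (hl a List.mem_cons_self).resolve_left ha
      rw [if_neg ha]
      cases n with
      | zero => simp [eulerTerm]
      | succ n =>
        -- Multiplying by a geometric series without constant term sums the coefficients of index at
        -- most `n`. Decoding the tail with preceding letter `a` supplies `a ^ k`, which completes
        -- the geometric coefficient to `a ^ (n + 1)`.
        have h1 : PowerSeries.coeff (n + 1) (letterSeries a * wordSeries w) =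
            (a : ℝ) ^ (n + 1) * eulerPartial (decodeWord a w) n := by
          rw [mul_comm, PowerSeries.coeff_mul, Finset.Nat.sum_antidiagonal_eq_sum_range_succ
            (fun i j => PowerSeries.coeff i (wordSeries w) * PowerSeries.coeff j (letterSeries a)),
            Finset.sum_range_succ, ← sum_eulerTerm, Finset.mul_sum]
          rw [letterSeries, if_neg ha]
          simp only [PowerSeries.coeff_mk, Nat.sub_self, if_true, mul_zero, add_zero]
          refine Finset.sum_congr rfl fun k hk => ?_
          have hk' : k < n + 1 := Finset.mem_range.1 hk
          rw [ih hl' hg.2 ha' k, if_neg (by omega), mul_right_comm, ← pow_add,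
            Nat.add_sub_cancel' hk'.le]
        have h2 : (e * a).natAbs = 1 ∧ (e * a).sign = e * a := by
          rcases he with rfl | rfl <;> rcases ha' with rfl | rfl <;> decide
        have h3 : (e : ℝ) ^ (n + 1) * (e : ℝ) ^ (n + 1) = 1 := by
          rw [← mul_pow]
          rcases he with rfl | rfl <;> simp
        rw [h1, eulerTerm, h2.1, h2.2]
        push_cast
        rw [mul_pow, pow_one]
        linear_combination (-(a : ℝ) ^ (n + 1) * eulerPartial (decodeWord a w) n /
          ((n : ℝ) + 1)) * h3

/-! ### Cauchy products of slowly convergent series -/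

/-- The fourth root is subadditive here, and `(x + y) ^ 3 ≤ 4 * (x ^ 3 + y ^ 3)`; dividing by `x ^ 3
* y ^ 3` separates the two factors as in a partial fraction. -/
lemma inv_mul_inv_fourthRoot_le (j k : ℕ) :
    1 / (fourthRoot j ^ 3 * fourthRoot k ^ 3) ≤
      4 / fourthRoot (j + k) ^ 3 * (1 / fourthRoot j ^ 3 + 1 / fourthRoot k ^ 3) := by
  have hj := fourthRoot_pos j
  have hk := fourthRoot_pos k
  have hn := fourthRoot_pos (j + k)
  have h1 : fourthRoot (j + k) ≤ fourthRoot j + fourthRoot k := by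
    refine le_of_pow_le_pow_left₀ (n := 4) (by norm_num) (by positivity) ?_
    have h2 := fourthRoot_pow_four j
    have h3 := fourthRoot_pow_four k
    have h4 := fourthRoot_pow_four (j + k)
    push_cast at h4
    have : 0 ≤ 4 * fourthRoot j ^ 3 * fourthRoot k + 6 * fourthRoot j ^ 2 * fourthRoot k ^ 2 +
      4 * fourthRoot j * fourthRoot k ^ 3 := by positivity
    nlinarith
  set x := fourthRoot j
  set y := fourthRoot k
  set z := fourthRoot (j + k)
  have h5 : z ^ 3 ≤ 4 * (x ^ 3 + y ^ 3) := by
    calc z ^ 3 ≤ (x + y) ^ 3 := by gcongr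
      _ ≤ _ := by nlinarith [mul_nonneg (add_pos hj hk).le (sq_nonneg (x - y))]
  have h6 : 4 / z ^ 3 * (1 / x ^ 3 + 1 / y ^ 3) = 4 * (x ^ 3 + y ^ 3) / z ^ 3 / (x ^ 3 * y ^ 3) := by
    field_simp
    ring
  rw [h6]
  gcongr
  rwa [le_div_iff₀ (by positivity), one_mul]

/-- After the separation both sums agree under the reflection of `j`, and each is `O(N ^ (1/4))`,
against a prefactor `N ^ (-3/4)`. -/
lemma sum_inv_mul_inv_fourthRoot_le (N : ℕ) :
    ∑ j ∈ Finset.range (N + 1), 1 / (fourthRoot j ^ 3 * fourthRoot (N - j) ^ 3) ≤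
      512 / fourthRoot N ^ 2 := by
  have hN := fourthRoot_pos N
  have h1 : ∑ j ∈ Finset.range (N + 1), 1 / fourthRoot (N - j) ^ 3 =
      ∑ j ∈ Finset.range (N + 1), 1 / fourthRoot j ^ 3 := by
    rw [← Finset.sum_range_reflect]
    refine Finset.sum_congr rfl fun j hj => ?_
    have := Finset.mem_range.1 hj
    rw [show N + 1 - 1 - j = N - j by omega, show N - (N - j) = j by omega]
  have h2 : ∑ j ∈ Finset.range (N + 1), 1 / fourthRoot j ^ 3 ≤ 64 * fourthRoot N :=
    (sum_inv_fourthRoot_le (N + 1)).trans (by linarith [fourthRoot_succ_le N])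
  calc _ ≤ ∑ j ∈ Finset.range (N + 1), 4 / fourthRoot N ^ 3 *
        (1 / fourthRoot j ^ 3 + 1 / fourthRoot (N - j) ^ 3) := by
        refine Finset.sum_le_sum fun j hj => ?_
        have h3 := inv_mul_inv_fourthRoot_le j (N - j)
        rwa [Nat.add_sub_cancel' (Nat.lt_succ_iff.1 (Finset.mem_range.1 hj))] at h3
    _ = 4 / fourthRoot N ^ 3 * (2 * ∑ j ∈ Finset.range (N + 1), 1 / fourthRoot j ^ 3) := by
        rw [← Finset.mul_sum, Finset.sum_add_distrib, h1, two_mul]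
    _ ≤ 4 / fourthRoot N ^ 3 * (2 * (64 * fourthRoot N)) := by gcongr
    _ = _ := by field_simp; norm_num

/-- A form of Mertens' theorem on Cauchy products, for conditionally convergent series with a rate
of convergence. -/
lemma tendsto_mul_sub_cauchyProduct {A B : ℕ → ℝ} {C D L : ℝ} (hC : 0 ≤ C) (hD : 0 ≤ D)
    (hA : ∀ n, |A n| ≤ C / fourthRoot n ^ 3)
    (hB : ∀ n, |∑ k ∈ Finset.range (n + 1), B k - L| ≤ D / fourthRoot n ^ 3) :
    Tendsto (fun N => (∑ k ∈ Finset.range (N + 1), A k) * (∑ k ∈ Finset.range (N + 1), B k) -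
      ∑ n ∈ Finset.range (N + 1), ∑ k ∈ Finset.range (n + 1), A k * B (n - k)) atTop (𝓝 0) := by
  refine squeeze_zero_norm (a := fun N => 1024 * C * D / fourthRoot N ^ 2) (fun N => ?_)
    (tendsto_const_div_fourthRoot_pow _ two_ne_zero)
  -- Summed over the triangle, the difference pairs each `A j` with a tail piece of `B` from `N - j`
  -- to `N`. Only the size of `A j` enters, so the sum of `A` may diverge.
  rw [Finset.sum_range_diag_flip (N + 1) (fun m k => A m * B k), Finset.sum_mul,
    ← Finset.sum_sub_distrib, Real.norm_eq_abs]
  refine (Finset.abs_sum_le_sum_abs _ _).trans ?_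
  calc _ ≤ ∑ j ∈ Finset.range (N + 1), 2 * C * D *
        (1 / (fourthRoot j ^ 3 * fourthRoot (N - j) ^ 3)) := by
        refine Finset.sum_le_sum fun j hj => ?_
        have hjN : j ≤ N := Nat.lt_succ_iff.1 (Finset.mem_range.1 hj)
        have hq := fourthRoot_pos j
        have hp := fourthRoot_pos (N - j)
        rw [← Finset.mul_sum, ← mul_sub, abs_mul, show N + 1 - j = N - j + 1 by omega]
        have h1 := abs_sub_le (∑ k ∈ Finset.range (N + 1), B k) L
          (∑ k ∈ Finset.range (N - j + 1), B k)
        rw [abs_sub_comm L] at h1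
        have h2 : D / fourthRoot N ^ 3 ≤ D / fourthRoot (N - j) ^ 3 := by
          gcongr
          exact fourthRoot_mono (Nat.sub_le N j)
        have h3 : |∑ k ∈ Finset.range (N + 1), B k - ∑ k ∈ Finset.range (N - j + 1), B k| ≤
            2 * (D / fourthRoot (N - j) ^ 3) := by
          linarith [hB N, hB (N - j)]
        calc _ ≤ (C / fourthRoot j ^ 3) * (2 * (D / fourthRoot (N - j) ^ 3)) :=
              mul_le_mul (hA j) h3 (abs_nonneg _) (by positivity)
          _ = _ := by field_simp
    _ ≤ 2 * C * D * (512 / fourthRoot N ^ 2) := by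
        rw [← Finset.mul_sum]
        exact mul_le_mul_of_nonneg_left (sum_inv_mul_inv_fourthRoot_le N) (by positivity)
    _ = _ := by ring

lemma exists_abs_eulerTerm_le {s : List ℤ} (hs : ∀ x ∈ s, x ≠ 0) :
    ∃ C, 0 ≤ C ∧ ∀ n, |eulerTerm s n| ≤ C / fourthRoot n ^ 3 := by
  obtain ⟨C, hC, h⟩ := exists_abs_eulerPartial_sub_le_inv hs
  -- The shift from `n` to `n + 1` costs `2 ^ 3`; the extra 1 covers the term at 0 of the empty
  -- index.
  refine ⟨8 * C + 1, by positivity, fun n => ?_⟩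
  have h0 : fourthRoot 0 = 1 := by simp [fourthRoot]
  cases n with
  | zero =>
    rw [h0]
    cases s with
    | nil => simpa [eulerTerm] using hC
    | cons a t => simp only [eulerTerm, abs_zero]; positivity
  | succ n =>
    have hq := fourthRoot_pos n
    have hq' := fourthRoot_pos (n + 1)
    have h1 := h n
    rw [← sum_eulerTerm, ← sum_eulerTerm, Finset.sum_range_succ _ (n + 1), add_sub_cancel_left]
      at h1
    have h2 : fourthRoot (n + 1) ^ 3 ≤ 8 * fourthRoot n ^ 3 := by
      calc fourthRoot (n + 1) ^ 3 ≤ (2 * fourthRoot n) ^ 3 := by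
            gcongr
            exact fourthRoot_succ_le n
        _ = _ := by ring
    refine h1.trans ?_
    rw [div_le_div_iff₀ (by positivity) (by positivity)]
    have h3 := mul_le_mul_of_nonneg_left h2 hC
    have h4 := pow_pos hq 3
    nlinarith

/-- The product of two truncated sums is asymptotically given by the shuffle product, provided
one of the factors converges. -/
theorem tendsto_mul_sub_shuffle {u v : List ℤ} (hu : ∀ x ∈ u, x = 0 ∨ x = 1 ∨ x = -1)
    (hv : ∀ x ∈ v, x = 0 ∨ x = 1 ∨ x = -1) (hgu : GoodWord u) (hgv : GoodWord v)
    (hsv : IsEulerIndex (decodeWord 1 v))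
    (hl : ∀ w ∈ shuffle u v, GoodWord w ∧ ∀ x ∈ w, x = 0 ∨ x = 1 ∨ x = -1) :
    Tendsto (fun N => eulerPartial (decodeWord 1 u) N * eulerPartial (decodeWord 1 v) N -
      ((shuffle u v).map fun w => eulerPartial (decodeWord 1 w) N).sum) atTop (𝓝 0) := by
  have hterm : ∀ w, (∀ x ∈ w, x = 0 ∨ x = 1 ∨ x = -1) → GoodWord w → ∀ n,
      eulerTerm (decodeWord 1 w) n = PowerSeries.coeff n (wordSeries w) := fun w hw hg n => by
    rw [coeff_wordSeries hw hg (Or.inl rfl) n]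
    simp
  obtain ⟨C, hC, hA⟩ := exists_abs_eulerTerm_le (decodeWord_entries hu (Or.inl rfl))
  obtain ⟨D, hD, hB⟩ := exists_abs_eulerPartial_sub_eulerSum_le hsv
  have key := tendsto_mul_sub_cauchyProduct (A := eulerTerm (decodeWord 1 u))
    (B := eulerTerm (decodeWord 1 v)) hC hD hA (fun n => by rw [sum_eulerTerm]; exact hB n)
  refine key.congr fun N => ?_
  rw [sum_eulerTerm, sum_eulerTerm]
  congr 1
  have h1 : ∀ n, ∑ k ∈ Finset.range (n + 1), eulerTerm (decodeWord 1 u) k *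
      eulerTerm (decodeWord 1 v) (n - k) =
      ((shuffle u v).map fun w => eulerTerm (decodeWord 1 w) n).sum := by
    intro n
    have h2 : (shuffle u v).map (fun w => eulerTerm (decodeWord 1 w) n) =
        ((shuffle u v).map wordSeries).map (PowerSeries.coeff n) := by
      rw [List.map_map]
      exact List.map_congr_left fun w hw => hterm w (hl w hw).2 (hl w hw).1 n
    rw [h2, ← map_list_sum, ← wordSeries_mul hgu hgv, PowerSeries.coeff_mul,
      Finset.Nat.sum_antidiagonal_eq_sum_range_succ
        (fun i j => PowerSeries.coeff i (wordSeries u) * PowerSeries.coeff j (wordSeries v))]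
    exact Finset.sum_congr rfl fun k _ => by rw [hterm u hu hgu, hterm v hv hgv]
  rw [Finset.sum_congr rfl fun n _ => h1 n]
  simp only [← sum_eulerTerm]
  generalize shuffle u v = l
  induction l with
  | nil => simp
  | cons w l ih => simp only [List.map_cons, List.sum_cons, Finset.sum_add_distrib, ih]

/-! ### Regularization and double shuffle relations -/

/-- The expansion of the regularized Euler sum of an index with at most one leading `1`. -/
def regExpand : List ℤ → List (ℤ × List ℤ)
  | [] => [(1, [])]
  | a :: t => if a = 1 then (stuffle [1] t).tail.map fun w => (-1, w) else [(1, a :: t)]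

/-- The value of a formal linear combination of Euler sums. -/
noncomputable def eulerValue (l : List (ℤ × List ℤ)) : ℝ :=
  (l.map fun p => (p.1 : ℝ) * eulerSum p.2).sum

lemma eulerValue_append (l m : List (ℤ × List ℤ)) :
    eulerValue (l ++ m) = eulerValue l + eulerValue m := by
  simp [eulerValue]

lemma eulerValue_map_neg (l : List (List ℤ)) :
    eulerValue (l.map fun w => (-1, w)) = -(l.map eulerSum).sum := by
  induction l with
  | nil => simp [eulerValue]
  | cons w l ih =>
    simp only [eulerValue, List.map_cons, List.sum_cons] at ih ⊢
    rw [ih]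
    push_cast
    ring

/-- Indices of convergent Euler sums, possibly preceded by one `1`. -/
def IsRegIndex (s : List ℤ) : Prop := IsEulerIndex s ∨ ∃ t, IsEulerIndex t ∧ s = 1 :: t

/-- Apart from the dropped leading term, each product term begins with the first entry of `t` or
with a merged entry of absolute value at least 2. -/
lemma mem_tail_stuffle_one {t w : List ℤ} (ht : IsEulerIndex t)
    (hw : w ∈ (stuffle [1] t).tail) : IsEulerIndex w := by
  obtain ⟨h0, h1⟩ := ht
  cases t with
  | nil => simp [stuffle_nil_right] at hw
  | cons a t =>
    refine ⟨ne_zero_of_mem_stuffle (by simp) h0 (List.mem_of_mem_tail hw), ?_⟩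
    have ha := h0 a List.mem_cons_self
    have ha1 : a ≠ 1 := by simpa using h1
    rw [stuffle_cons_cons] at hw
    simp only [stuffle, List.map_cons, List.map_nil, List.cons_append, List.nil_append,
      List.tail_cons, List.mem_append, List.mem_map, List.mem_singleton] at hw
    rcases hw with ⟨w, hw, rfl⟩ | rfl
    · simpa using ha1
    · have : mergeEntry 1 a ≠ 1 := by
        rcases lt_or_gt_of_ne ha with h | h
        · rw [mergeEntry, Int.sign_eq_neg_one_of_neg h, Int.sign_one]; omega
        · rw [mergeEntry, Int.sign_eq_one_of_pos h, Int.sign_one]; omega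
      simpa using this

lemma stuffle_one_eq_cons_tail (t : List ℤ) :
    stuffle [1] t = (1 :: t) :: (stuffle [1] t).tail := by
  cases t <;> simp [stuffle, stuffleStep]

/-- After subtracting a multiple of the harmonic numbers, the truncated sums converge to the
regularized Euler sum. -/
lemma exists_tendsto_sub_harmonic {s : List ℤ} (hs : IsRegIndex s) :
    ∃ c : ℝ, Tendsto (fun N => eulerPartial s N - c * eulerPartial [1] N) atTop
      (𝓝 (eulerValue (regExpand s))) := by
  rcases hs with hs | ⟨t, ht, rfl⟩
  · refine ⟨0, ?_⟩
    have h : eulerValue (regExpand s) = eulerSum s := by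
      cases s with
      | nil => simp [regExpand, eulerValue]
      | cons a t =>
        have ha1 : a ≠ 1 := by simpa using hs.2
        simp [regExpand, ha1, eulerValue]
    rw [h]
    simpa using tendsto_eulerPartial hs
  -- The quasi-shuffle product with `[1]` expresses the divergent sum through the harmonic number
  -- times the truncated sum of `t`. Replacing the latter by its limit costs `O(N ^ (1/4 - 3/4))`.
  · refine ⟨eulerSum t, ?_⟩
    rw [regExpand, if_pos rfl, eulerValue_map_neg]
    have h1 : ∀ N, eulerPartial (1 :: t) N - eulerSum t * eulerPartial [1] N =
        eulerPartial [1] N * (eulerPartial t N - eulerSum t) -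
          ((stuffle [1] t).tail.map (eulerPartial · N)).sum := by
      intro N
      have h2 := eulerPartial_mul (u := [1]) (by simp) ht.1 N
      rw [stuffle_one_eq_cons_tail, List.map_cons, List.sum_cons] at h2
      linear_combination (-1 : ℝ) * h2
    simp only [h1]
    rw [← zero_sub]
    refine Tendsto.sub ?_ (tendsto_list_sum _ fun w hw =>
      tendsto_eulerPartial (mem_tail_stuffle_one ht hw))
    obtain ⟨C, hC, hc⟩ := exists_abs_eulerPartial_le (s := [1]) (by simp)
    obtain ⟨D, hD, hd⟩ := exists_abs_eulerPartial_sub_eulerSum_le ht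
    refine squeeze_zero_norm (a := fun N => C * D / fourthRoot N ^ 2) (fun N => ?_)
      (tendsto_const_div_fourthRoot_pow _ two_ne_zero)
    have hq := fourthRoot_pos N
    rw [norm_mul, Real.norm_eq_abs, Real.norm_eq_abs]
    calc _ ≤ (C * fourthRoot N) * (D / fourthRoot N ^ 3) :=
          mul_le_mul (hc N) (hd N) (abs_nonneg _) (by positivity)
      _ = _ := by field_simp

lemma tendsto_harmonic_atTop : Tendsto (eulerPartial [1]) atTop atTop := by
  refine Real.tendsto_sum_range_one_div_nat_succ_atTop.congr fun n => ?_
  simp [eulerPartial]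

lemma exists_tendsto_sum_sub_harmonic {l : List (List ℤ)} (hl : ∀ s ∈ l, IsRegIndex s) :
    ∃ c : ℝ, Tendsto (fun N => (l.map (eulerPartial · N)).sum - c * eulerPartial [1] N) atTop
      (𝓝 (eulerValue (l.flatMap regExpand))) := by
  induction l with
  | nil => exact ⟨0, by simp [eulerValue]⟩
  | cons s l ih =>
    obtain ⟨c, hc⟩ := exists_tendsto_sub_harmonic (hl s List.mem_cons_self)
    obtain ⟨d, hd⟩ := ih fun t ht => hl t (List.mem_cons_of_mem _ ht)
    refine ⟨c + d, ?_⟩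
    rw [List.flatMap_cons, eulerValue_append]
    refine (hc.add hd).congr fun N => ?_
    rw [List.map_cons, List.sum_cons]
    ring

/-- The regularized double shuffle relations, for words with at most one leading `1`. -/
theorem double_shuffle {u v : List ℤ} (hu : ∀ x ∈ u, x = 0 ∨ x = 1 ∨ x = -1)
    (hv : ∀ x ∈ v, x = 0 ∨ x = 1 ∨ x = -1) (hgu : GoodWord u) (hgv : GoodWord v)
    (hsv : IsEulerIndex (decodeWord 1 v))
    (hl : ∀ w ∈ shuffle u v, GoodWord w ∧ (∀ x ∈ w, x = 0 ∨ x = 1 ∨ x = -1) ∧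
      IsRegIndex (decodeWord 1 w))
    (hst : ∀ s ∈ stuffle (decodeWord 1 u) (decodeWord 1 v), IsRegIndex s) :
    eulerValue ((stuffle (decodeWord 1 u) (decodeWord 1 v)).flatMap regExpand) =
      eulerValue (((shuffle u v).map (decodeWord 1)).flatMap regExpand) := by
  have h1 := tendsto_mul_sub_shuffle hu hv hgu hgv hsv fun w hw => ⟨(hl w hw).1, (hl w hw).2.1⟩
  obtain ⟨c, hc⟩ := exists_tendsto_sum_sub_harmonic hst
  obtain ⟨d, hd⟩ := exists_tendsto_sum_sub_harmonic (l := (shuffle u v).map (decodeWord 1))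
    fun s hs => by
      obtain ⟨w, hw, rfl⟩ := List.mem_map.1 hs
      exact (hl w hw).2.2
  simp only [eulerPartial_mul (decodeWord_entries hu (Or.inl rfl))
    (decodeWord_entries hv (Or.inl rfl))] at h1
  have h2 := (hc.sub hd).sub h1
  rw [sub_zero] at h2
  have h3 : Tendsto (fun N => (d - c) * eulerPartial [1] N) atTop
      (𝓝 (eulerValue ((stuffle (decodeWord 1 u) (decodeWord 1 v)).flatMap regExpand) -
        eulerValue (((shuffle u v).map (decodeWord 1)).flatMap regExpand))) := by
    refine h2.congr fun N => ?_
    rw [List.map_map]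
    simp only [Function.comp_def]
    ring
  -- A nonzero multiple of the harmonic numbers cannot converge.
  have h4 : d - c = 0 := by
    rcases lt_trichotomy (d - c) 0 with h | h | h
    · exact absurd h3 (not_tendsto_nhds_of_tendsto_atBot
        (tendsto_harmonic_atTop.const_mul_atTop_of_neg h) _)
    · exact h
    · exact absurd h3 (not_tendsto_nhds_of_tendsto_atTop
        (tendsto_harmonic_atTop.const_mul_atTop h) _)
  simp only [h4, zero_mul] at h3
  exact sub_eq_zero.1 (tendsto_nhds_unique h3 tendsto_const_nhds)

/-! ### Verified sparse elimination over the integers -/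

/-- A linear form in countably many unknowns, as a list of positions and coefficients. -/
abbrev SparseRow := List (ℕ × ℤ)

/-- The value of a linear form. -/
def rowValue {R : Type*} [Ring R] (z : ℕ → R) (r : SparseRow) : R :=
  (r.map fun p => (p.2 : R) * z p.1).sum

/-- Prepend an entry unless its coefficient vanishes. -/
def consEntry (k : ℕ) (c : ℤ) (r : SparseRow) : SparseRow :=
  cond (Nat.beq c.natAbs 0) r ((k, c) :: r)

/-- The recursion of `combineRows` in its second argument. Recursors are used here and below since
they reduce faster than structural recursion. -/
noncomputable def combineStep (a b : ℤ) (k : ℕ) (c : ℤ) (f : SparseRow → SparseRow)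
    (t : SparseRow) : SparseRow :=
  t.rec ((k, a * c) :: f [])
    fun q t g => cond (Nat.blt k q.1) ((k, a * c) :: f (q :: t))
      (cond (Nat.blt q.1 k) ((q.1, b * q.2) :: g) (consEntry k (a * c + b * q.2) (f t)))

/-- The linear combination `a * s + b * t` of two linear forms with increasing positions. -/
noncomputable def combineRows (a b : ℤ) (s : SparseRow) : SparseRow → SparseRow :=
  s.rec (List.map fun p => (p.1, b * p.2)) fun q _ f => combineStep a b q.1 q.2 f

/-- The greatest common divisor of the coefficients. -/
noncomputable def rowContent (r : SparseRow) : ℕ := r.rec 0 fun p _ g => Nat.gcd p.2.natAbs g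

/-- Divide the coefficients by their greatest common divisor. -/
noncomputable def primitiveRow (r : SparseRow) : SparseRow :=
  cond (Nat.ble (rowContent r) 1) r (r.map fun p => (p.1, p.2 / (rowContent r : ℤ)))

/-- Eliminate the unknown `k` by means of the pivot `a * z k + p`. -/
noncomputable def reduceRow (k : ℕ) (a : ℤ) (p : SparseRow) : SparseRow → SparseRow
  | [] => []
  | (l, b) :: s => cond (Nat.beq l k) (primitiveRow (combineRows a (-b) s p)) ((l, b) :: s)

/-- Insert a row at the second place. -/
def insertSecond (r : SparseRow) : List SparseRow → List SparseRow
  | [] => [r]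
  | p :: rs => p :: r :: rs

/-- Move the first row that starts with the unknown `k` to the front, and drop the zero rows
before it. -/
def pivotFirst (k : ℕ) : List SparseRow → List SparseRow
  | [] => []
  | [] :: rs => pivotFirst k rs
  | (p :: s) :: rs => cond (Nat.beq p.1 k) ((p :: s) :: rs)
      (insertSecond (p :: s) (pivotFirst k rs))

/-- Gaussian elimination of `n` unknowns from the unknown `k` on; the result tells whether there
is a pivot at every step. -/
noncomputable def eliminate : ℕ → ℕ → List SparseRow → Bool
  | 0, _, _ => true
  | n + 1, k, rows => match pivotFirst k rows with
    | [] => false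
    | [] :: _ => false
    | ((l, a) :: p) :: rs => Nat.beq l k && !Nat.beq a.natAbs 0 && p.all (fun q => Nat.blt k q.1) &&
        eliminate n (k + 1) (rs.map (reduceRow k a p))

section RowValue

variable {R : Type*} [CommRing R] (z : ℕ → R)

lemma rowValue_nil : rowValue z [] = 0 := by simp [rowValue]

lemma rowValue_cons (p : ℕ × ℤ) (r : SparseRow) :
    rowValue z (p :: r) = p.2 * z p.1 + rowValue z r := by
  simp [rowValue]

lemma rowValue_consEntry (k : ℕ) (c : ℤ) (r : SparseRow) :
    rowValue z (consEntry k c r) = c * z k + rowValue z r := by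
  rw [consEntry]
  cases h : Nat.beq c.natAbs 0
  · simp [rowValue_cons]
  · have : c = 0 := Int.natAbs_eq_zero.1 (Nat.eq_of_beq_eq_true h)
    simp [this]

lemma rowValue_map_mul (b : ℤ) (r : SparseRow) :
    rowValue z (r.map fun p => (p.1, b * p.2)) = b * rowValue z r := by
  induction r with
  | nil => simp [rowValue]
  | cons p r ih =>
    rw [List.map_cons, rowValue_cons, rowValue_cons, ih]
    push_cast
    ring

/-- No ordering of positions is assumed: it affects only whether like entries meet and cancel, so
soundness needs no sortedness invariant. -/
lemma rowValue_combineRows (a b : ℤ) (s t : SparseRow) :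
    rowValue z (combineRows a b s t) = a * rowValue z s + b * rowValue z t := by
  induction s generalizing t with
  | nil =>
    rw [rowValue_nil, mul_zero, zero_add]
    exact rowValue_map_mul z b t
  | cons p s ih =>
    obtain ⟨k, c⟩ := p
    change rowValue z (combineStep a b k c (combineRows a b s) t) = _
    induction t with
    | nil =>
      change rowValue z ((k, a * c) :: combineRows a b s []) = _
      rw [rowValue_cons, rowValue_cons, ih, rowValue_nil]
      push_cast
      ring
    | cons q t iht =>
      obtain ⟨l, d⟩ := q
      change rowValue z (cond (Nat.blt k l) ((k, a * c) :: combineRows a b s ((l, d) :: t))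
        (cond (Nat.blt l k) ((l, b * d) :: combineStep a b k c (combineRows a b s) t)
          (consEntry k (a * c + b * d) (combineRows a b s t)))) = _
      cases h1 : Nat.blt k l
      · cases h2 : Nat.blt l k
        · obtain rfl : k = l := by
            have h1' : ¬ k < l := fun h => by
              rw [show Nat.blt k l = true by rwa [Nat.blt_eq]] at h1
              exact absurd h1 (by decide)
            have h2' : ¬ l < k := fun h => by
              rw [show Nat.blt l k = true by rwa [Nat.blt_eq]] at h2
              exact absurd h2 (by decide)
            omega
          simp only [cond_false]
          rw [rowValue_consEntry, rowValue_cons, rowValue_cons, ih]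
          push_cast
          ring
        · simp only [cond_true, cond_false]
          simp only [rowValue_cons, iht]
          push_cast
          ring
      · rw [cond_true, rowValue_cons, rowValue_cons, ih]
        push_cast
        ring

/-- Removes the basis positions, where the defects are already known to vanish. -/
lemma rowValue_filter {f : ℕ × ℤ → Bool} (hf : ∀ p, f p = false → z p.1 = 0) (r : SparseRow) :
    rowValue z (r.filter f) = rowValue z r := by
  induction r with
  | nil => rfl
  | cons p r ih =>
    cases h : f p
    · rw [List.filter_cons_of_neg (by simp [h]), ih, rowValue_cons, hf p h, mul_zero, zero_add]
    · rw [List.filter_cons_of_pos h, rowValue_cons, rowValue_cons, ih]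

end RowValue

lemma rowContent_dvd (r : SparseRow) : ∀ p ∈ r, (rowContent r : ℤ) ∣ p.2 := by
  induction r with
  | nil => simp
  | cons q r ih =>
    have h1 : rowContent (q :: r) = Nat.gcd q.2.natAbs (rowContent r) := rfl
    intro p hp
    rcases List.mem_cons.1 hp with rfl | hp
    · rw [h1, Int.natCast_dvd]
      exact Nat.gcd_dvd_left _ _
    · refine dvd_trans ?_ (ih p hp)
      rw [h1]
      exact_mod_cast Nat.gcd_dvd_right _ _

lemma rowValue_primitiveRow {z : ℕ → ℝ} {r : SparseRow} (h : rowValue z r = 0) :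
    rowValue z (primitiveRow r) = 0 := by
  rw [primitiveRow]
  cases hb : Nat.ble (rowContent r) 1
  · have hg : rowContent r ≠ 0 := by
      rintro h0
      rw [h0] at hb
      exact absurd hb (by decide)
    have hd := rowContent_dvd r
    set g := rowContent r
    have hg' : (g : ℝ) ≠ 0 := by exact_mod_cast hg
    suffices rowValue z r = g * rowValue z (r.map fun p => (p.1, p.2 / (g : ℤ))) by
      rw [h] at this
      exact (mul_eq_zero.1 this.symm).resolve_left hg'
    clear h hb
    clear_value g
    induction r with
    | nil => simp [rowValue]
    | cons p r ih =>
      rw [List.map_cons, rowValue_cons, rowValue_cons,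
        ih fun q hq => hd q (List.mem_cons_of_mem _ hq)]
      obtain ⟨c, hc⟩ := hd p List.mem_cons_self
      have hgz : (g : ℤ) ≠ 0 := by exact_mod_cast hg
      rw [hc, Int.mul_ediv_cancel_left _ hgz]
      push_cast
      ring
  · exact h

lemma rowValue_reduceRow {z : ℕ → ℝ} {k : ℕ} {a : ℤ} {p r : SparseRow}
    (hp : rowValue z ((k, a) :: p) = 0) (hr : rowValue z r = 0) :
    rowValue z (reduceRow k a p r) = 0 := by
  cases r with
  | nil => exact hr
  | cons q s =>
    obtain ⟨l, b⟩ := q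
    rw [reduceRow]
    cases h : Nat.beq l k
    · exact hr
    · obtain rfl := Nat.eq_of_beq_eq_true h
      refine rowValue_primitiveRow ?_
      rw [rowValue_cons] at hp hr
      rw [rowValue_combineRows]
      push_cast
      linear_combination (a : ℝ) * hr - (b : ℝ) * hp

lemma mem_of_mem_pivotFirst {k : ℕ} {rows : List SparseRow} {r : SparseRow}
    (h : r ∈ pivotFirst k rows) : r ∈ rows := by
  induction rows with
  | nil => exact h
  | cons q rows ih =>
    cases q with
    | nil => exact List.mem_cons_of_mem _ (ih h)
    | cons p s =>
      rw [pivotFirst] at h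
      cases hb : Nat.beq p.1 k
      · rw [hb, cond_false] at h
        cases hp : pivotFirst k rows with
        | nil =>
          rw [hp] at h
          rw [List.mem_singleton.1 h]
          exact List.mem_cons_self
        | cons p qs =>
          rw [hp] at h ih
          simp only [insertSecond, List.mem_cons] at h ih ⊢
          tauto
      · rw [hb, cond_true] at h
        exact h

/-- If Gaussian elimination finds all pivots, then the unknowns vanish. -/
theorem eq_zero_of_eliminate {z : ℕ → ℝ} (n k : ℕ) (rows : List SparseRow)
    (hrows : ∀ r ∈ rows, rowValue z r = 0) (hz : ∀ j, k + n ≤ j → z j = 0)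
    (h : eliminate n k rows = true) : ∀ j, k ≤ j → z j = 0 := by
  induction n generalizing k rows with
  | zero => exact hz
  | succ n ih =>
    rw [eliminate] at h
    have hmem : ∀ r ∈ pivotFirst k rows, rowValue z r = 0 := fun r hr =>
      hrows r (mem_of_mem_pivotFirst hr)
    cases hp : pivotFirst k rows with
    | nil => simp [hp] at h
    | cons q rs =>
      rw [hp] at h hmem
      cases q with
      | nil => simp at h
      | cons e p =>
        obtain ⟨l, a⟩ := e
        simp only [Bool.and_eq_true, Bool.not_eq_true', List.all_eq_true] at h
        obtain ⟨⟨⟨h1, h2⟩, h3⟩, h4⟩ := h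
        obtain rfl := Nat.eq_of_beq_eq_true h1
        have hpiv := hmem _ List.mem_cons_self
        have ih' := ih (l + 1) _ (fun r hr => by
          obtain ⟨r, hr', rfl⟩ := List.mem_map.1 hr
          exact rowValue_reduceRow hpiv (hmem r (List.mem_cons_of_mem _ hr')))
          (fun j hj => hz j (by omega)) h4
        -- Back substitution: `eliminate` checked that the rest of the pivot row involves only later
        -- unknowns, which vanish by induction.
        have hp0 : rowValue z p = 0 := by
          refine List.sum_eq_zero fun x hx => ?_
          obtain ⟨q, hq, rfl⟩ := List.mem_map.1 hx
          have : l < q.1 := by simpa [Nat.blt_eq] using h3 q hq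
          rw [ih' q.1 this, mul_zero]
        have ha : (a : ℝ) ≠ 0 := by
          intro h0
          have : a = 0 := by exact_mod_cast h0
          simp [this] at h2
        intro j hj
        rcases hj.eq_or_lt with rfl | hj
        · rw [rowValue_cons, hp0, add_zero] at hpiv
          exact (mul_eq_zero.1 hpiv).resolve_left ha
        · exact ih' j hj

/-! ### The linear system in weight five -/

/-- The indices of `A, …, H`, with the unit vectors as coefficients. -/
def basisRows : List (List ℤ × (Fin 8 → ℤ)) := [
  ([-1, -1, -1, 2], ![1, 0, 0, 0, 0, 0, 0, 0]),
  ([-2, 1, -1, -1], ![0, 1, 0, 0, 0, 0, 0, 0]),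
  ([-1, 1, -1, -2], ![0, 0, 1, 0, 0, 0, 0, 0]),
  ([-2, 1, 1, 1], ![0, 0, 0, 1, 0, 0, 0, 0]),
  ([-1, -1, -1, 1, 1], ![0, 0, 0, 0, 1, 0, 0, 0]),
  ([2, 2, -1], ![0, 0, 0, 0, 0, 1, 0, 0]),
  ([-1, 1, -1, 1, -1], ![0, 0, 0, 0, 0, 0, 1, 0]),
  ([-1, -1, -1, -1, -1], ![0, 0, 0, 0, 0, 0, 0, 1])]

/-- All signed indices of weight five, with their coefficients. -/
def allRows : List (List ℤ × (Fin 8 → ℤ)) := integralTable.reverse ++ basisRows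

/-- A number that identifies a signed index of small weight. -/
def indexCode (s : List ℤ) : ℕ := s.foldr (fun a c => 12 * c + (a + 6).toNat) 0

/-- The first position of a number in a list. -/
noncomputable def findPosition (c : ℕ) (l : List ℕ) : ℕ :=
  l.rec 0 fun d _ n => cond (Nat.beq c d) 0 (Nat.succ n)

/-- The position of a signed index in `allRows`. -/
noncomputable def position (s : List ℤ) : ℕ :=
  findPosition (indexCode s) (allRows.map fun r => indexCode r.1)

/-- All words of a given length in the letters `0, 1, -1`. -/
def letterWords : ℕ → List (List ℤ)
  | 0 => [[]]
  | n + 1 => (letterWords n).flatMap fun w => [0 :: w, 1 :: w, -1 :: w]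

/-- The words that do not start with `1` and do not end with `0`. -/
def convergentWords (n : ℕ) : List (List ℤ) :=
  (letterWords n).filter fun w => decide (w.head? ≠ some 1) && decide (w.getLast? ≠ some 0)

/-- Pairs of words whose double shuffle relations determine the Euler sums of weight five. -/
def wordPairs : List (List ℤ × List ℤ) :=
  [[-1], [1]].flatMap (fun u => (convergentWords 4).map fun v => (u, v)) ++
    (convergentWords 2).flatMap (fun u => (convergentWords 3).map fun v => (u, v)) ++
    [([1, -1], [-1, -1, -1])]

/-- The difference of the two regularized products of a pair of words. -/
def relation (q : List ℤ × List ℤ) : List (ℤ × List ℤ) :=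
  (stuffle (decodeWord 1 q.1) (decodeWord 1 q.2)).flatMap regExpand ++
    (((shuffle q.1 q.2).map (decodeWord 1)).flatMap regExpand).map fun p => (-p.1, p.2)

/-- Collect the coefficients of a formal linear combination. -/
noncomputable def collect (l : List (ℤ × List ℤ)) : SparseRow :=
  l.foldr (fun p r => combineRows 1 1 [(position p.2, p.1)] r) []

/-- The tabulated coefficient at a position of `allRows`. -/
def tableCoeff (i : Fin 8) (k : ℕ) : ℤ := ((allRows[k]?).map fun r => r.2 i).getD 0

/-- The difference between an Euler sum and its tabulated value, by position in `allRows`. -/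
noncomputable def tableDefect (k : ℕ) : ℝ :=
  ((allRows[k]?).map fun r => eulerSum r.1).getD 0 - ∑ i, (tableCoeff i k : ℝ) * integralSum i

/-- The conditions under which the double shuffle relation of a pair of words applies, and the
consistency of the table with it. -/
def PairConsistent (q : List ℤ × List ℤ) : Prop :=
  ((∀ x ∈ q.1, x = 0 ∨ x = 1 ∨ x = -1) ∧ (∀ x ∈ q.2, x = 0 ∨ x = 1 ∨ x = -1)) ∧
  (q.1.getLast? ≠ some 0 ∧ q.2.getLast? ≠ some 0) ∧
  (decodeWord 1 q.2).head? ≠ some 1 ∧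
  (∀ s ∈ stuffle (decodeWord 1 q.1) (decodeWord 1 q.2) ++ (shuffle q.1 q.2).map (decodeWord 1),
    s.head? = some 1 → s.tail.head? ≠ some 1) ∧
  (∀ p ∈ relation q, (allRows[position p.2]?).map Prod.fst = some p.2) ∧
  ∀ i, rowValue (tableCoeff i) (collect (relation q)) = 0

noncomputable instance : DecidablePred PairConsistent := fun q => by
  unfold PairConsistent
  infer_instance

lemma goodWord_of_getLast? {w : List ℤ} (h : w.getLast? ≠ some 0) : GoodWord w := by
  induction w with
  | nil => trivial
  | cons a w ih =>
    cases w with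
    | nil => exact ⟨fun _ ha => h (by simp [ha]), trivial⟩
    | cons b w => exact ⟨fun hw => absurd hw (by simp), ih (by simpa using h)⟩

lemma goodWord_of_mem_shuffle {u v w : List ℤ} (hu : GoodWord u) (hv : GoodWord v)
    (hw : w ∈ shuffle u v) : GoodWord w := by
  induction u generalizing v w with
  | nil => rwa [List.mem_singleton.1 hw]
  | cons a u ihu =>
    induction v generalizing w with
    | nil =>
      rw [shuffle_nil_right] at hw
      rwa [List.mem_singleton.1 hw]
    | cons b v ihv =>
      rw [shuffle_cons_cons, List.mem_append, List.mem_map, List.mem_map] at hw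
      rcases hw with ⟨w, hw, rfl⟩ | ⟨w, hw, rfl⟩
      · exact ⟨fun h => absurd h (ne_nil_of_mem_shuffle (Or.inr (by simp)) hw), ihu hu.2 hv hw⟩
      · exact ⟨fun h => absurd h (ne_nil_of_mem_shuffle (Or.inl (by simp)) hw), ihv hv.2 hw⟩

lemma forall_mem_of_mem_shuffle {P : ℤ → Prop} {u v w : List ℤ} (hu : ∀ x ∈ u, P x)
    (hv : ∀ x ∈ v, P x) (hw : w ∈ shuffle u v) : ∀ x ∈ w, P x := by
  induction u generalizing v w with
  | nil => rwa [List.mem_singleton.1 hw]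
  | cons a u ihu =>
    induction v generalizing w with
    | nil =>
      rw [shuffle_nil_right] at hw
      rwa [List.mem_singleton.1 hw]
    | cons b v ihv =>
      rw [List.forall_mem_cons] at hu hv
      rw [shuffle_cons_cons, List.mem_append, List.mem_map, List.mem_map] at hw
      rcases hw with ⟨w, hw, rfl⟩ | ⟨w, hw, rfl⟩ <;> rw [List.forall_mem_cons]
      · exact ⟨hu.1, ihu hu.2 (List.forall_mem_cons.2 hv) hw⟩
      · exact ⟨hv.1, ihv hv.2 hw⟩

lemma isRegIndex_of_head {s : List ℤ} (h0 : ∀ x ∈ s, x ≠ 0)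
    (h : s.head? = some 1 → s.tail.head? ≠ some 1) : IsRegIndex s := by
  by_cases h1 : s.head? = some 1
  · right
    cases s with
    | nil => simp at h1
    | cons a t =>
      obtain rfl : a = 1 := by simpa using h1
      exact ⟨t, ⟨fun x hx => h0 x (List.mem_cons_of_mem _ hx), h rfl⟩, rfl⟩
  · exact Or.inl ⟨h0, h1⟩

lemma eulerValue_map_neg_fst (l : List (ℤ × List ℤ)) :
    eulerValue (l.map fun p => (-p.1, p.2)) = -eulerValue l := by
  induction l with
  | nil => simp [eulerValue]
  | cons p l ih =>
    simp only [eulerValue, List.map_cons, List.sum_cons] at ih ⊢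
    rw [ih]
    push_cast
    ring

lemma eulerValue_relation {q : List ℤ × List ℤ} (h : PairConsistent q) :
    eulerValue (relation q) = 0 := by
  obtain ⟨⟨hu, hv⟩, ⟨hlu, hlv⟩, hs, hreg, -, -⟩ := h
  have hu0 := decodeWord_entries hu (Or.inl rfl)
  have hv0 := decodeWord_entries hv (Or.inl rfl)
  rw [relation, eulerValue_append, eulerValue_map_neg_fst,
    double_shuffle hu hv (goodWord_of_getLast? hlu) (goodWord_of_getLast? hlv) ⟨hv0, hs⟩,
    add_neg_cancel]
  · intro w hw
    have hl := forall_mem_of_mem_shuffle hu hv hw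
    exact ⟨goodWord_of_mem_shuffle (goodWord_of_getLast? hlu) (goodWord_of_getLast? hlv) hw, hl,
      isRegIndex_of_head (decodeWord_entries hl (Or.inl rfl))
        (hreg _ (List.mem_append_right _ (List.mem_map_of_mem hw)))⟩
  · exact fun s hs => isRegIndex_of_head (ne_zero_of_mem_stuffle hu0 hv0 hs)
      (hreg _ (List.mem_append_left _ hs))

lemma rowValue_collect {R : Type*} [CommRing R] (z : ℕ → R) (l : List (ℤ × List ℤ)) :
    rowValue z (collect l) = (l.map fun p => (p.1 : R) * z (position p.2)).sum := by
  induction l with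
  | nil => exact rowValue_nil z
  | cons p l ih =>
    change rowValue z (combineRows 1 1 [(position p.2, p.1)] (collect l)) = _
    rw [rowValue_combineRows, ih, rowValue_cons, rowValue_nil, List.map_cons, List.sum_cons]
    push_cast
    ring

/-- Linearity separates analysis from arithmetic: the Euler sums satisfy the relation by double
shuffle, while the tabulated part stays an integer computation that the kernel can decide. -/
lemma rowValue_tableDefect {l : List (ℤ × List ℤ)}
    (hl : ∀ p ∈ l, (allRows[position p.2]?).map Prod.fst = some p.2) :
    rowValue tableDefect (collect l) = eulerValue l -
      ∑ i, ((rowValue (tableCoeff i) (collect l) : ℤ) : ℝ) * integralSum i := by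
  simp only [rowValue_collect]
  induction l with
  | nil => simp [eulerValue]
  | cons p l ih =>
    have h1 : tableDefect (position p.2) =
        eulerSum p.2 - ∑ i, (tableCoeff i (position p.2) : ℝ) * integralSum i := by
      -- The lookup is certified for each index, so injectivity of `indexCode` is never needed.
      have h2 := hl p List.mem_cons_self
      rw [tableDefect]
      cases h3 : allRows[position p.2]? with
      | none => simp [h3] at h2
      | some r =>
        rw [h3] at h2
        simp only [Option.map_some, Option.some.injEq] at h2
        simp [h2]
    simp only [eulerValue, List.map_cons, List.sum_cons] at ih ⊢
    rw [ih fun q hq => hl q (List.mem_cons_of_mem _ hq), h1]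
    push_cast
    simp only [add_mul, Finset.sum_add_distrib, mul_sub, Finset.mul_sum, mul_assoc]
    ring

lemma pairConsistent_wordPairs : ∀ q ∈ wordPairs, PairConsistent q := by decide +kernel

/-- This is the full-rank statement for the 100 positions outside the basis; entries at the basis
positions are dropped beforehand. -/
lemma eliminate_wordPairs : eliminate 100 0 (wordPairs.map fun q =>
    (collect (relation q)).filter fun p => Nat.blt p.1 100) = true := by decide +kernel

lemma eulerSum_basisRows : ∀ r ∈ basisRows, eulerSum r.1 = ∑ i, (r.2 i : ℝ) * integralSum i := by
  simp [basisRows, integralSum, Fin.sum_univ_succ]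

/-- Such a position either holds a basis index, whose row is a unit vector, or lies past the end of
the list, where the default 0 applies to both parts. -/
lemma tableDefect_of_le {k : ℕ} (hk : 100 ≤ k) : tableDefect k = 0 := by
  have hlen : integralTable.reverse.length = 100 := by decide +kernel
  simp only [tableDefect, tableCoeff]
  rw [allRows, List.getElem?_append_right (by omega)]
  cases h : basisRows[k - integralTable.reverse.length]? with
  | none => simp
  | some r =>
    have := eulerSum_basisRows r (List.mem_of_getElem? h)
    simp [this]

lemma tableDefect_eq_zero (k : ℕ) : tableDefect k = 0 := by
  refine eq_zero_of_eliminate (z := tableDefect) 100 0 _ (fun r hr => ?_)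
    (fun j hj => tableDefect_of_le (by omega)) eliminate_wordPairs k (Nat.zero_le k)
  obtain ⟨q, hq, rfl⟩ := List.mem_map.1 hr
  have hc := pairConsistent_wordPairs q hq
  rw [rowValue_filter tableDefect (fun p hp => tableDefect_of_le ?_),
    rowValue_tableDefect hc.2.2.2.2.1, eulerValue_relation hc]
  · simp [hc.2.2.2.2.2]
  · by_contra h
    rw [show Nat.blt p.1 100 = true by rw [Nat.blt_eq]; omega] at hp
    exact absurd hp (by decide)

/-- The tabulated values of the Euler sums of weight five are correct. -/
theorem eulerSum_allRows {r : List ℤ × (Fin 8 → ℤ)} (hr : r ∈ allRows) :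
    eulerSum r.1 = ∑ i, (r.2 i : ℝ) * integralSum i := by
  obtain ⟨k, hk⟩ := List.mem_iff_getElem?.1 hr
  have h := tableDefect_eq_zero k
  simp only [tableDefect, tableCoeff, hk] at h
  simpa using sub_eq_zero.1 h

/-! ### Completeness of the table -/

/-- All signed indices of a given weight. -/
def indicesOfWeight : ℕ → List (List ℤ)
  | 0 => [[]]
  | n + 1 => (indicesOfWeight n).flatMap fun t =>
      [1 :: t, -1 :: t] ++ if t = [] then [] else [bumpHead t]

lemma mem_indicesOfWeight {n : ℕ} {s : List ℤ} (h0 : ∀ x ∈ s, x ≠ 0) (hn : eulerWeight s = n) :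
    s ∈ indicesOfWeight n := by
  induction n generalizing s with
  | zero =>
    cases s with
    | nil => simp [indicesOfWeight]
    | cons a t =>
      have := Int.natAbs_pos.2 (h0 a List.mem_cons_self)
      simp [eulerWeight] at hn
      omega
  | succ n ih =>
    cases s with
    | nil => simp [eulerWeight] at hn
    | cons a t =>
      have ha := h0 a List.mem_cons_self
      have ht := fun x hx => h0 x (List.mem_cons_of_mem a hx)
      have hn' : a.natAbs + eulerWeight t = n + 1 := by simpa [eulerWeight] using hn
      rw [indicesOfWeight, List.mem_flatMap]
      by_cases h1 : a.natAbs = 1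
      · refine ⟨t, ih ht (by omega), ?_⟩
        rcases Int.natAbs_eq_iff.1 h1 with rfl | rfl <;> simp
      -- Lowering the absolute value of the first entry by one inverts `bumpHead` and reduces the
      -- weight.
      · obtain ⟨b, hb, hbn, rfl⟩ : ∃ b : ℤ, b ≠ 0 ∧ b.natAbs + 1 = a.natAbs ∧ b + b.sign = a := by
          rcases lt_or_gt_of_ne ha with h | h
          · exact ⟨a + 1, by omega, by omega, by rw [Int.sign_eq_neg_one_of_neg (by omega)]; ring⟩
          · exact ⟨a - 1, by omega, by omega, by rw [Int.sign_eq_one_of_pos (by omega)]; ring⟩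
        refine ⟨b :: t, ih (List.forall_mem_cons.2 ⟨hb, ht⟩) ?_, by simp [bumpHead]⟩
        simp only [eulerWeight, List.map_cons, List.sum_cons] at hn' ⊢
        omega

lemma exists_mem_allRows {s : List ℤ} (hs : IsEulerIndex s) (hw : eulerWeight s = 5) :
    ∃ r ∈ allRows, r.1 = s := by
  have key : ∀ s ∈ indicesOfWeight 5, s.head? = some 1 ∨
      (allRows[position s]?).map Prod.fst = some s := by decide +kernel
  have h := (key s (mem_indicesOfWeight hs.1 hw)).resolve_left hs.2
  obtain ⟨r, hr, rfl⟩ := Option.map_eq_some_iff.1 h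
  exact ⟨r, List.mem_of_getElem? hr, rfl⟩

lemma eulerSum_integralTable {row : List ℤ × (Fin 8 → ℤ)} (h : row ∈ integralTable) :
    eulerSum row.1 = ∑ i, (row.2 i : ℝ) * integralSum i :=
  eulerSum_allRows (List.mem_append_left _ (List.mem_reverse.2 h))

/-! ### Zlobin's sums -/

/-- The coefficients of `A, …, H` with respect to Zlobin's sums. -/
def zlobinCoeff : Fin 8 → Fin 8 → ℚ :=
  ![![0, 0, 0, 1, 1, 0, 0, 2], ![0, 17, 7455 / 13, -9, 192, 521 / 13, 541 / 13, 28],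
    ![0, 0, 1, 1, 0, 1, 1, 0], ![0, 0, 1, 0, 0, 0, 0, 0], ![1, 0, 0, 1, 0, 0, 0, 0],
    ![0, 0, 536 / 3, 0, 72, 8, 26 / 3, 19], ![1, 1, 402 / 13, 0, 11, 28 / 13, 29 / 13, 2],
    ![1, 0, 0, 1, 1, 0, 0, 1]]

/-- The integral coefficients of Zlobin's sums with respect to `A, …, H`. -/
lemma zlobinSum_eq (i : Fin 8) :
    zlobinSum i = ∑ j, ((![![-191, 26, -18, 384, -266, -9, -442, 709],
      ![-122, 17, -13, 242, -170, -6, -288, 458], ![0, 0, 0, 1, 0, 0, 0, 0],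
      ![191, -26, 18, -384, 267, 9, 442, -709], ![190, -26, 18, -384, 265, 9, 442, -707],
      ![12622, -1729, 1210, -25281, 17568, 597, 29393, -46961],
      ![-12813, 1755, -1227, 25664, -17835, -606, -29835, 47670],
      ![-190, 26, -18, 384, -266, -9, -442, 708]] : Fin 8 → Fin 8 → ℤ) i j : ℝ) *
        integralSum j := by
  have h : ∀ (s : List ℤ) (c : Fin 8 → ℤ),
      (allRows[position s]?).map (fun r => (r.1, List.ofFn r.2)) = some (s, List.ofFn c) →
      eulerSum s = ∑ j, (c j : ℝ) * integralSum j := by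
    intro s c hsc
    obtain ⟨r, hr, hrs⟩ := Option.map_eq_some_iff.1 hsc
    obtain ⟨rfl, hc⟩ := Prod.mk.inj hrs
    -- The lookup compares coefficient vectors as lists; injectivity of `List.ofFn` returns to the
    -- vectors.
    rw [← List.ofFn_injective hc]
    exact eulerSum_allRows (List.mem_of_getElem? hr)
  fin_cases i <;> exact h _ _ (by decide +kernel)

/-- Substituting `zlobinSum_eq` reduces this to checking that `zlobinCoeff` inverts the integer
matrix there. -/
lemma integralSum_eq (j : Fin 8) : integralSum j = ∑ i, (zlobinCoeff j i : ℝ) * zlobinSum i := by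
  simp only [zlobinSum_eq]
  fin_cases j <;> simp [zlobinCoeff, Fin.sum_univ_succ] <;> ring

lemma eulerSum_eq_zlobin {s : List ℤ} {c : Fin 8 → ℤ}
    (h : eulerSum s = ∑ j, (c j : ℝ) * integralSum j) :
    eulerSum s = ∑ i, ((∑ j, (c j : ℚ) * zlobinCoeff j i : ℚ) : ℝ) * zlobinSum i := by
  rw [h]
  simp only [integralSum_eq, Finset.mul_sum]
  rw [Finset.sum_comm]
  refine Finset.sum_congr rfl fun i _ => ?_
  push_cast
  rw [Finset.sum_mul]
  exact Finset.sum_congr rfl fun j _ => by ring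

lemma eulerSum_three_one_one : eulerSum [3, 1, 1] = -(448 / 39) * eulerSum [-2, 1, 1, 1]
    - 112 / 39 * eulerSum [-2, 2, 1] - 48 / 13 * eulerSum [-2, 1, 2] := by
  have h := eulerSum_eq_zlobin (eulerSum_integralTable (row := ([3, 1, 1],
    ![-9808, 1344, -944, 19632, -13648, -464, -22848, 36496]))
    (by simp [integralTable, integralTable3]))
  have hc : (fun i => ∑ j, ((![-9808, 1344, -944, 19632, -13648, -464, -22848, 36496] :
      Fin 8 → ℤ) j : ℚ) * zlobinCoeff j i) =
      ![0, 0, -(448 / 39), 0, 0, -(48 / 13), -(112 / 39), 0] := by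
    funext i
    fin_cases i <;> simp [zlobinCoeff, Fin.sum_univ_succ] <;> norm_num
  have hc' := fun i => congrFun hc i
  rw [h]
  simp only [hc']
  simp [zlobinSum, Fin.sum_univ_succ]
  ring

theorem proposition3p6 :
    -- the defining series of all Euler sums of weight five converge
    (∀ s : List ℤ, IsEulerIndex s → eulerWeight s = 5 →
      Tendsto (eulerPartial s) atTop (𝓝 (eulerSum s))) ∧
    -- rational linear combinations of Zlobin's sums
    (∀ s : List ℤ, IsEulerIndex s → eulerWeight s = 5 →
      ∃ q : Fin 8 → ℚ, eulerSum s = ∑ i, (q i : ℝ) * zlobinSum i) ∧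
    (eulerSum [3, 1, 1] = -(448 / 39) * eulerSum [-2, 1, 1, 1]
      - 112 / 39 * eulerSum [-2, 2, 1] - 48 / 13 * eulerSum [-2, 1, 2]) ∧
    -- integral linear combinations of `A, …, H`, with all coefficients
    (∀ s : List ℤ, IsEulerIndex s → eulerWeight s = 5 →
      ∃ c : Fin 8 → ℤ, eulerSum s = ∑ i, (c i : ℝ) * integralSum i) ∧
    (∀ row ∈ integralTable, eulerSum row.1 = ∑ i, (row.2 i : ℝ) * integralSum i) ∧
    -- Zlobin's sums cannot be linearly independent and generate all Euler sums over the integers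
    ¬ (LinearIndependent ℚ zlobinSum ∧
      eulerSumsOfWeight 5 ⊆ (Submodule.span ℤ (Set.range zlobinSum) : Set ℝ)) := by
  refine ⟨fun s hs _ => tendsto_eulerPartial hs, fun s hs hw => ?_, eulerSum_three_one_one,
    fun s hs hw => ?_, fun row hrow => eulerSum_integralTable hrow, ?_⟩
  · obtain ⟨r, hr, rfl⟩ := exists_mem_allRows hs hw
    exact ⟨_, eulerSum_eq_zlobin (eulerSum_allRows hr)⟩
  · obtain ⟨r, hr, rfl⟩ := exists_mem_allRows hs hw
    exact ⟨r.2, eulerSum_allRows hr⟩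
  · rintro ⟨hli, hspan⟩
    have hmem : eulerSum [3, 1, 1] ∈ Submodule.span ℤ (Set.range zlobinSum) :=
      hspan ⟨[3, 1, 1], by simp [IsEulerIndex], by simp [eulerWeight], rfl⟩
    obtain ⟨c, hc⟩ := (Submodule.mem_span_range_iff_exists_fun ℤ).1 hmem
    -- The integral expansion given by the span is compared with the rational one in
    -- `eulerSum_three_one_one`.
    have h1 : ∑ i, ((c i : ℚ) - ![0, 0, -(448 / 39), 0, 0, -(48 / 13), -(112 / 39), 0] i) •
        zlobinSum i = 0 := by
      have h2 := hc.trans eulerSum_three_one_one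
      simp [zlobinSum, Fin.sum_univ_succ, Rat.smul_def] at h2 ⊢
      linear_combination h2
    -- Position 2 is `eulerSum [-2, 1, 1, 1]`, with rational coefficient `-448/39`; since 39 does
    -- not divide 448, no integer can equal it.
    have h2 := Fintype.linearIndependent_iff.1 hli _ h1 2
    have h3 : (39 * c 2 : ℚ) = -448 := by
      simp at h2
      linarith
    have h4 : 39 * c 2 = -448 := by exact_mod_cast h3
    omega
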